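/- All spaces are real. Let $1\le p\le\infty$ and let $\ell^p_n$ be $\mathbb R^n$ with the $p$-norm. A \emph{$p$-multinormed space} is a Banach space $X$ with norms $\|\cdot\|_n$ on $\ell^p_n\otimes X\cong X^n$ ($n\ge 0$) such that (i) $\|a\otimes x\|_n=\|a\|\,\|x\|$ for $a\in\ell^p_n$, $x\in X$; (ii) $\|u\|_n\ge|\langle a^*\otimes x^*,u\rangle|$ for $u\in\ell^p_n\otimes X$ and all $a^*\in(\ell^p_n)^*$, $x^*\in X^*$ of norm at most $1$; (iii) $\|(T\otimes I_X)u\|_m\le\|T\|\,\|u\|_n$ for every linear $T:\ell^p_n\to\ell^p_m$ and $u\in\ell^p_n\otimes X$. A subspace of $X$ carries the restricted norms. For a linear map $u:X\to Y$ between $p$-multinormed spaces, $\|u\|_p=\sup_n\|I_{\ell^p_n}\otimes u\|$, and $u$ is \emph{$p$-multibounded} if $\|u\|_p<\infty$. A linear map $q:Y\to X$ is a \emph{$p$-quotient map} if, for every $n$, $I_{\ell^p_n}\otimes q$ maps the open unit ball of $\ell^p_n\otimes Y$ onto the open unit ball of $\ell^p_n\otimes X$. A $p$-multinormed space $Z$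 is \emph{$1$-projective} if for every $p$-quotient map $q:Y\to X$ of $p$-multinormed spaces, every $p$-multibounded $u:Z\to X$ and every $\varepsilon>0$ there is a linear $\tilde u:Z\to Y$ with $q\tilde u=u$ and $\|\tilde u\|_p\le\|u\|_p+\varepsilon$. For a Banach space $E$, $\min_p(E)$ and $\max_p(E)$ denote $E$ with the injective, respectively projective, tensor norms on $\ell^p_n\otimes E$. A $p$-multinormed space $Y$ \emph{contains a copy} of $X$ if there is a linear bijection $e$ from $X$ onto a subspace of $Y$ such that $e$ and $e^{-1}$ are $p$-multibounded. \textbf{Corollary.} (1) For $1\le p\le\infty$, every infinite-dimensional closed subspace of a $1$-projective $p$-multinormed space contains a copy of $\max_p(\ell^1)$. (2) Let $1<p<\infty$ and $1/p+1/p'=1$. For every measure $\mu$, the $p$-multinormed space $\min_p(L^{p'}(\mu))$ is $1$-projective if and only if $L^{p'}(\mu)$ is finite dimensional. -/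

import Mathlib

open scoped ENNReal

universe w

set_option linter.unusedSectionVars false

/-- The real sequence space `ℓ^p_n`. -/
abbrev SeqLp (p : ℝ≥0∞) (n : ℕ) : Type := PiLp p fun _ : Fin n => ℝ

/-- For `T : ℓ^p_n → ℓ^p_m`, the operator `T ⊗ I_X : ℓ^p_n ⊗ X → ℓ^p_m ⊗ X`, where
`ℓ^p_n ⊗ X` is identified with `X^n` through `∑ i, δ_i ⊗ x_i ↔ (x_1, …, x_n)`. -/
def tensorId {p : ℝ≥0∞} [Fact (1 ≤ p)] {X : Type*} [AddCommGroup X] [Module ℝ X] {n m : ℕ}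
    (T : SeqLp p n →L[ℝ] SeqLp p m) (x : Fin n → X) : Fin m → X :=
  fun i => ∑ j, T (PiLp.single p j 1) i • x j

/-- The value of the functional `a ⊗ f` on `∑ i, δ_i ⊗ x_i`. -/
def tensorPair {p : ℝ≥0∞} [Fact (1 ≤ p)] {X : Type*} [NormedAddCommGroup X] [NormedSpace ℝ X]
    {n : ℕ} (a : SeqLp p n →L[ℝ] ℝ) (f : X →L[ℝ] ℝ) (x : Fin n → X) : ℝ :=
  ∑ i, a (PiLp.single p i 1) * f (x i)

/-- A `p`-multinorm structure on the normed space `X`: a tensorial sequence of cross-norms on the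
spaces `ℓ^p_n ⊗ X`, `n = 0, 1, 2, …`. The space `ℓ^p_n ⊗ X` is identified with `X^n` through
`∑ i, δ_i ⊗ x_i ↔ (x_1, …, x_n)`; so `a ⊗ x` is `(a_1 x, …, a_n x)`.
Definiteness of the norms follows from `le_cross`, see `PMultinorm.eq_zero`. -/
structure PMultinorm (p : ℝ≥0∞) [Fact (1 ≤ p)] (X : Type*) [NormedAddCommGroup X]
    [NormedSpace ℝ X] where
  /-- The norm on `ℓ^p_n ⊗ X`. -/
  norm : ∀ n : ℕ, Seminorm ℝ (Fin n → X)
  cross : ∀ (n : ℕ) (a : SeqLp p n) (x : X), norm n (fun i => a i • x) = ‖a‖ * ‖x‖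
  le_cross : ∀ (n : ℕ) (u : Fin n → X) (a : SeqLp p n →L[ℝ] ℝ) (f : X →L[ℝ] ℝ),
    ‖a‖ ≤ 1 → ‖f‖ ≤ 1 → |tensorPair a f u| ≤ norm n u
  tensorial : ∀ (n m : ℕ) (T : SeqLp p n →L[ℝ] SeqLp p m) (u : Fin n → X),
    norm m (tensorId T u) ≤ ‖T‖ * norm n u

section

variable {p : ℝ≥0∞} [Fact (1 ≤ p)] {X : Type*} [NormedAddCommGroup X] [NormedSpace ℝ X]

theorem tensorPair_add {n : ℕ} (a : SeqLp p n →L[ℝ] ℝ) (f : X →L[ℝ] ℝ) (x y : Fin n → X) :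
    tensorPair a f (x + y) = tensorPair a f x + tensorPair a f y := by
  simp [tensorPair, mul_add, Finset.sum_add_distrib]

theorem tensorPair_smul {n : ℕ} (a : SeqLp p n →L[ℝ] ℝ) (f : X →L[ℝ] ℝ) (c : ℝ)
    (x : Fin n → X) : tensorPair a f (c • x) = c * tensorPair a f x := by
  simp only [tensorPair, Pi.smul_apply, map_smul, smul_eq_mul, Finset.mul_sum]
  exact Finset.sum_congr rfl fun i _ => by ring

theorem SeqLp.eq_sum_single {n : ℕ} (a : SeqLp p n) :
    a = ∑ i, a i • (PiLp.single p i (1 : ℝ) : SeqLp p n) := by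
  ext j
  simp [Pi.single_apply]

theorem SeqLp.map_eq_sum {n : ℕ} {F : Type*} [AddCommGroup F] [Module ℝ F]
    [TopologicalSpace F] (T : SeqLp p n →L[ℝ] F) (a : SeqLp p n) :
    T a = ∑ i, a i • T (PiLp.single p i 1) := by
  conv_lhs => rw [SeqLp.eq_sum_single a]
  simp [map_sum]

theorem SeqLp.sum_apply {n k : ℕ} (f : Fin k → SeqLp p n) (i : Fin n) :
    (∑ j, f j) i = ∑ j, f j i := by
  simp

theorem tensorPair_tmul {n : ℕ} (a : SeqLp p n →L[ℝ] ℝ) (f : X →L[ℝ] ℝ) (b : SeqLp p n)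
    (x : X) : tensorPair a f (fun i => b i • x) = a b * f x := by
  rw [SeqLp.map_eq_sum a b, Finset.sum_mul]
  simp only [tensorPair, map_smul, smul_eq_mul]
  exact Finset.sum_congr rfl fun i _ => by ring

theorem tensorId_tmul {n m : ℕ} (T : SeqLp p n →L[ℝ] SeqLp p m) (a : SeqLp p n) (x : X) :
    tensorId T (fun i => a i • x) = fun i => T a i • x := by
  funext i
  rw [SeqLp.map_eq_sum T a, SeqLp.sum_apply, Finset.sum_smul]
  simp only [tensorId, smul_smul, PiLp.smul_apply, smul_eq_mul]
  exact Finset.sum_congr rfl fun j _ => by rw [mul_comm]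

theorem tensorPair_tensorId {n m : ℕ} (T : SeqLp p n →L[ℝ] SeqLp p m)
    (a : SeqLp p m →L[ℝ] ℝ) (f : X →L[ℝ] ℝ) (x : Fin n → X) :
    tensorPair a f (tensorId T x) = tensorPair (a.comp T) f x := by
  simp only [tensorPair, tensorId, map_sum, map_smul, smul_eq_mul, Finset.mul_sum,
    ContinuousLinearMap.comp_apply]
  rw [Finset.sum_comm]
  refine Finset.sum_congr rfl fun j _ => ?_
  rw [SeqLp.map_eq_sum a (T _), Finset.sum_mul]
  simp only [smul_eq_mul]
  exact Finset.sum_congr rfl fun i _ => by ring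

namespace PMultinorm

theorem eq_zero (α : PMultinorm p X) {n : ℕ} (u : Fin n → X) (hu : α.norm n u = 0) : u = 0 := by
  funext i
  by_contra hi
  obtain ⟨f, hf1, hf2⟩ := exists_dual_vector ℝ (u i) (norm_ne_zero_iff.2 hi)
  let a : SeqLp p n →L[ℝ] ℝ := PiLp.proj p (fun _ : Fin n => ℝ) i
  have ha : ‖a‖ ≤ 1 := ContinuousLinearMap.opNorm_le_bound _ zero_le_one fun x => by
    rw [one_mul]; exact PiLp.norm_apply_le x i
  have h := α.le_cross n u a f ha hf1.le
  rw [hu] at h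
  have h2 : tensorPair a f u = ‖u i‖ := by
    simp only [tensorPair, a, PiLp.proj_apply, PiLp.single_apply]
    simpa using hf2
  rw [h2, abs_of_nonneg (norm_nonneg _)] at h
  exact hi (norm_le_zero_iff.1 h)

/-- A tensorial sequence of seminorms with the first cross-norm property has the second one. -/
noncomputable def ofTensorial (N : ∀ n : ℕ, Seminorm ℝ (Fin n → X))
    (hc : ∀ (n : ℕ) (a : SeqLp p n) (x : X), N n (fun i => a i • x) = ‖a‖ * ‖x‖)
    (ht : ∀ (n m : ℕ) (T : SeqLp p n →L[ℝ] SeqLp p m) (u : Fin n → X),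
      N m (tensorId T u) ≤ ‖T‖ * N n u) : PMultinorm p X where
  norm := N
  cross := hc
  tensorial := ht
  le_cross := by
    intro n u a f ha hf
    let e : SeqLp p 1 := PiLp.single p 0 1
    have he : 0 < ‖e‖ := norm_pos_iff.2 fun h => by
      have := congrArg (fun x : SeqLp p 1 => x 0) h
      simp [e] at this
    have h1 := ht n 1 (a.smulRight e) u
    have h2 : tensorId (a.smulRight e) u =
        fun i => e i • ∑ j, a (PiLp.single p j 1) • u j := by
      funext i
      simp only [tensorId, ContinuousLinearMap.smulRight_apply, PiLp.smul_apply, smul_eq_mul,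
        Finset.smul_sum, smul_smul]
      exact Finset.sum_congr rfl fun j _ => by rw [mul_comm]
    rw [h2, hc, ContinuousLinearMap.norm_smulRight_apply] at h1
    have h3 : ‖∑ j, a (PiLp.single p j 1) • u j‖ ≤ N n u := by
      have h0 : 0 ≤ N n u := apply_nonneg _ _
      have h4 : ‖e‖ * ‖∑ j, a (PiLp.single p j 1) • u j‖ ≤ ‖e‖ * N n u :=
        h1.trans (by
          rw [mul_assoc]
          exact mul_le_of_le_one_left (by positivity) ha)
      exact le_of_mul_le_mul_left h4 he
    have h5 : tensorPair a f u = f (∑ j, a (PiLp.single p j 1) • u j) := by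
      simp [tensorPair, map_sum]
    rw [h5]
    exact (f.le_of_opNorm_le hf _).trans (by simpa using h3)

/-- The `p`-multinorm structure inherited by a linear subspace. -/
noncomputable def restrict (α : PMultinorm p X) (W : Submodule ℝ X) : PMultinorm p W :=
  ofTensorial
    (fun n => (α.norm n).comp (W.subtype.compLeft (Fin n)))
    (by
      intro n a x
      exact α.cross n a (x : X))
    (by
      intro n m T u
      have h : W.subtype.compLeft (Fin m) (tensorId T u) =
          tensorId T (W.subtype.compLeft (Fin n) u) := by
        funext i
        simp [tensorId, LinearMap.compLeft]
      rw [Seminorm.comp_apply, Seminorm.comp_apply, h]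
      exact α.tensorial n m T _)

end PMultinorm

/-- The injective tensor norm on `ℓ^p_n ⊗ E`. -/
noncomputable def injNorm (p : ℝ≥0∞) [Fact (1 ≤ p)] {E : Type*} [NormedAddCommGroup E]
    [NormedSpace ℝ E] (n : ℕ) (x : Fin n → E) : ℝ :=
  sSup {r | ∃ (a : SeqLp p n →L[ℝ] ℝ) (f : E →L[ℝ] ℝ), ‖a‖ ≤ 1 ∧ ‖f‖ ≤ 1 ∧
    r = |tensorPair a f x|}

/-- The projective tensor norm on `ℓ^p_n ⊗ E`: the infimum of `∑ j, ‖a_j‖ ‖e_j‖` over all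
representations `∑ j, a_j ⊗ e_j` of the given tensor. -/
noncomputable def projNorm (p : ℝ≥0∞) [Fact (1 ≤ p)] {E : Type*} [NormedAddCommGroup E]
    [NormedSpace ℝ E] (n : ℕ) (x : Fin n → E) : ℝ :=
  sInf {r | ∃ (k : ℕ) (a : Fin k → SeqLp p n) (e : Fin k → E),
    x = (∑ j, fun i => a j i • e j) ∧ r = ∑ j, ‖a j‖ * ‖e j‖}

theorem abs_tensorPair_le {n : ℕ} (a : SeqLp p n →L[ℝ] ℝ) (f : X →L[ℝ] ℝ) (ha : ‖a‖ ≤ 1)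
    (hf : ‖f‖ ≤ 1) (x : Fin n → X) :
    |tensorPair a f x| ≤ ∑ i, ‖(PiLp.single p i 1 : SeqLp p n)‖ * ‖x i‖ := by
  refine (Finset.abs_sum_le_sum_abs _ _).trans (Finset.sum_le_sum fun i _ => ?_)
  rw [abs_mul]
  have h1 := a.le_of_opNorm_le ha (PiLp.single p i 1)
  have h2 := f.le_of_opNorm_le hf (x i)
  rw [one_mul, Real.norm_eq_abs] at h1 h2
  exact mul_le_mul h1 h2 (abs_nonneg _) (norm_nonneg _)

theorem tensorPair_le_injNorm {n : ℕ} (a : SeqLp p n →L[ℝ] ℝ) (f : X →L[ℝ] ℝ) (ha : ‖a‖ ≤ 1)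
    (hf : ‖f‖ ≤ 1) (x : Fin n → X) : |tensorPair a f x| ≤ injNorm p n x := by
  refine le_csSup ⟨∑ i, ‖(PiLp.single p i 1 : SeqLp p n)‖ * ‖x i‖, ?_⟩ ⟨a, f, ha, hf, rfl⟩
  rintro r ⟨a, f, ha, hf, rfl⟩
  exact abs_tensorPair_le a f ha hf x

theorem injNorm_le {n : ℕ} (x : Fin n → X) (C : ℝ)
    (h : ∀ (a : SeqLp p n →L[ℝ] ℝ) (f : X →L[ℝ] ℝ), ‖a‖ ≤ 1 → ‖f‖ ≤ 1 →
      |tensorPair a f x| ≤ C) : injNorm p n x ≤ C := by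
  refine csSup_le ⟨_, 0, 0, by simp, by simp, rfl⟩ ?_
  rintro r ⟨a, f, ha, hf, rfl⟩
  exact h a f ha hf

theorem injNorm_nonneg {n : ℕ} (x : Fin n → X) : 0 ≤ injNorm p n x :=
  (abs_nonneg _).trans (tensorPair_le_injNorm 0 0 (by simp) (by simp) x)

theorem exists_norming {F : Type*} [NormedAddCommGroup F] [NormedSpace ℝ F] (x : F) :
    ∃ f : F →L[ℝ] ℝ, ‖f‖ ≤ 1 ∧ f x = ‖x‖ := by
  obtain ⟨f, hf, hfx⟩ := exists_dual_vector'' ℝ x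
  exact ⟨f, hf, by simpa using hfx⟩

theorem injNorm_tmul {n : ℕ} (a : SeqLp p n) (x : X) :
    injNorm p n (fun i => a i • x) = ‖a‖ * ‖x‖ := by
  apply le_antisymm
  · refine injNorm_le _ _ fun b f hb hf => ?_
    rw [tensorPair_tmul, abs_mul]
    have h1 := b.le_of_opNorm_le hb a
    have h2 := f.le_of_opNorm_le hf x
    rw [one_mul, Real.norm_eq_abs] at h1 h2
    exact mul_le_mul h1 h2 (abs_nonneg _) (norm_nonneg _)
  · obtain ⟨b, hb, hba⟩ := exists_norming a
    obtain ⟨f, hf, hfx⟩ := exists_norming x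
    have h := tensorPair_le_injNorm b f hb hf (fun i => a i • x)
    rw [tensorPair_tmul, hba, hfx] at h
    exact (le_abs_self _).trans h

theorem projNorm_le_of_repr {n k : ℕ} (a : Fin k → SeqLp p n) (e : Fin k → X) :
    projNorm p n (∑ j, fun i => a j i • e j) ≤ ∑ j, ‖a j‖ * ‖e j‖ := by
  refine csInf_le ⟨0, ?_⟩ ⟨k, a, e, rfl, rfl⟩
  rintro r ⟨k, a, e, -, rfl⟩
  positivity

theorem exists_repr {n : ℕ} (x : Fin n → X) :
    x = ∑ j, fun i => (PiLp.single p j 1 : SeqLp p n) i • x j := by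
  funext i
  simp [Finset.sum_apply, PiLp.single_apply]

theorem le_projNorm {n : ℕ} (x : Fin n → X) (C : ℝ)
    (h : ∀ (k : ℕ) (a : Fin k → SeqLp p n) (e : Fin k → X),
      x = (∑ j, fun i => a j i • e j) → C ≤ ∑ j, ‖a j‖ * ‖e j‖) : C ≤ projNorm p n x := by
  refine le_csInf ⟨_, n, _, _, exists_repr (p := p) x, rfl⟩ ?_
  rintro r ⟨k, a, e, hx, rfl⟩
  exact h k a e hx

theorem projNorm_add_le {n : ℕ} (x y : Fin n → X) :
    projNorm p n (x + y) ≤ projNorm p n x + projNorm p n y := by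
  rw [← sub_le_iff_le_add]
  refine le_projNorm (p := p) x _ fun k a e hx => ?_
  rw [sub_le_comm]
  refine le_projNorm (p := p) y _ fun l b g hy => ?_
  rw [sub_le_iff_le_add']
  have h := projNorm_le_of_repr (Fin.append a b) (Fin.append e g)
  simpa only [Fin.sum_univ_add, Fin.append_left, Fin.append_right, ← hx, ← hy] using h

theorem projNorm_smul_le {n : ℕ} (c : ℝ) (x : Fin n → X) :
    projNorm p n (c • x) ≤ ‖c‖ * projNorm p n x := by
  rcases eq_or_ne c 0 with rfl | hc
  · have h := projNorm_le_of_repr (p := p) (n := n) (k := 0) (X := X) Fin.elim0 Fin.elim0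
    simpa using h
  · rw [← div_le_iff₀' (norm_pos_iff.2 hc)]
    refine le_projNorm x _ fun k a e hx => ?_
    rw [div_le_iff₀' (norm_pos_iff.2 hc)]
    have h := projNorm_le_of_repr a (fun j => c • e j)
    have h2 : (∑ j, fun i => a j i • c • e j) = c • x := by
      rw [hx, Finset.smul_sum]
      refine Finset.sum_congr rfl fun j _ => ?_
      funext i
      simp [smul_comm c]
    rw [h2] at h
    refine h.trans (le_of_eq ?_)
    rw [Finset.mul_sum]
    exact Finset.sum_congr rfl fun j _ => by rw [norm_smul]; ring

theorem tensorPair_zero {n : ℕ} (a : SeqLp p n →L[ℝ] ℝ) (f : X →L[ℝ] ℝ) :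
    tensorPair a f 0 = 0 := by
  simp [tensorPair]

theorem injNorm_le_projNorm {n : ℕ} (x : Fin n → X) : injNorm p n x ≤ projNorm p n x := by
  refine injNorm_le _ _ fun b f hb hf => le_projNorm _ _ fun k a e hx => ?_
  have h : tensorPair b f x = ∑ j, b (a j) * f (e j) := by
    simp only [← tensorPair_tmul]
    rw [hx]
    exact map_sum (⟨⟨tensorPair b f, tensorPair_zero b f⟩, tensorPair_add b f⟩ :
      (Fin n → X) →+ ℝ) _ _
  rw [h]
  refine (Finset.abs_sum_le_sum_abs _ _).trans (Finset.sum_le_sum fun j _ => ?_)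
  rw [abs_mul]
  have h1 := b.le_of_opNorm_le hb (a j)
  have h2 := f.le_of_opNorm_le hf (e j)
  rw [one_mul, Real.norm_eq_abs] at h1 h2
  exact mul_le_mul h1 h2 (abs_nonneg _) (norm_nonneg _)

theorem projNorm_tensorId_le {n m : ℕ} (T : SeqLp p n →L[ℝ] SeqLp p m) (x : Fin n → X) :
    projNorm p m (tensorId T x) ≤ ‖T‖ * projNorm p n x := by
  have key : ∀ (k : ℕ) (a : Fin k → SeqLp p n) (e : Fin k → X),
      x = (∑ j, fun i => a j i • e j) →
        projNorm p m (tensorId T x) ≤ ∑ j, ‖T (a j)‖ * ‖e j‖ := by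
    intro k a e hx
    have h := projNorm_le_of_repr (fun j => T (a j)) e
    have h2 : tensorId T x = ∑ j, fun i => T (a j) i • e j := by
      simp only [← tensorId_tmul]
      rw [hx]
      funext i
      simp only [tensorId, Finset.sum_apply, Finset.smul_sum]
      rw [Finset.sum_comm]
    rwa [← h2] at h
  rcases eq_or_ne ‖T‖ 0 with h0 | h0
  · have h := key n _ _ (exists_repr (p := p) x)
    rw [norm_eq_zero.1 h0] at h ⊢
    simpa using h
  · have hT : 0 < ‖T‖ := lt_of_le_of_ne (norm_nonneg _) (Ne.symm h0)
    rw [← div_le_iff₀' hT]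
    refine le_projNorm _ _ fun k a e hx => ?_
    rw [div_le_iff₀' hT, Finset.mul_sum]
    refine (key k a e hx).trans (Finset.sum_le_sum fun j _ => ?_)
    rw [← mul_assoc]
    exact mul_le_mul_of_nonneg_right (T.le_opNorm _) (norm_nonneg _)

end

/-- The minimal `p`-multinorm structure `min_p(E)`, given by `ℓ^p_n ⊗ E` with the injective
tensor norm. -/
noncomputable def minMultinorm (p : ℝ≥0∞) [Fact (1 ≤ p)] (E : Type*) [NormedAddCommGroup E]
    [NormedSpace ℝ E] : PMultinorm p E where
  norm n := Seminorm.ofSMulLE (injNorm p n)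
    (le_antisymm (injNorm_le _ _ fun a f _ _ => by rw [tensorPair_zero, abs_zero])
      (injNorm_nonneg _))
    (fun x y => injNorm_le _ _ fun a f ha hf => by
      rw [tensorPair_add]
      exact (abs_add_le _ _).trans
        (add_le_add (tensorPair_le_injNorm a f ha hf x) (tensorPair_le_injNorm a f ha hf y)))
    (fun c x => injNorm_le _ _ fun a f ha hf => by
      rw [tensorPair_smul, abs_mul, Real.norm_eq_abs]
      exact mul_le_mul_of_nonneg_left (tensorPair_le_injNorm a f ha hf x) (abs_nonneg _))
  cross _ a x := injNorm_tmul a x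
  le_cross _ u a f ha hf := tensorPair_le_injNorm a f ha hf u
  tensorial n m T u := by
    refine injNorm_le _ _ fun a f ha hf => ?_
    rw [tensorPair_tensorId]
    rcases eq_or_ne ‖T‖ 0 with h0 | h0
    · rw [norm_eq_zero.1 h0]
      simp [tensorPair]
    · have hT : 0 < ‖T‖ := lt_of_le_of_ne (norm_nonneg _) (Ne.symm h0)
      have h := tensorPair_le_injNorm (‖T‖⁻¹ • a.comp T) f (by
        rw [norm_smul, norm_inv, norm_norm, inv_mul_le_one₀ hT]
        exact (a.opNorm_comp_le T).trans (mul_le_of_le_one_left hT.le ha)) hf u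
      have h2 : tensorPair (a.comp T) f u = ‖T‖ * tensorPair (‖T‖⁻¹ • a.comp T) f u := by
        simp only [tensorPair, Finset.mul_sum, _root_.smul_apply, smul_eq_mul]
        exact Finset.sum_congr rfl fun i _ => by field_simp
      rw [h2, abs_mul, abs_norm]
      exact mul_le_mul_of_nonneg_left h hT.le

/-- The maximal `p`-multinorm structure `max_p(E)`, given by `ℓ^p_n ⊗ E` with the projective
tensor norm. -/
noncomputable def maxMultinorm (p : ℝ≥0∞) [Fact (1 ≤ p)] (E : Type*) [NormedAddCommGroup E]
    [NormedSpace ℝ E] : PMultinorm p E :=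
  PMultinorm.ofTensorial
    (fun n => Seminorm.ofSMulLE (projNorm p n)
      (le_antisymm
        (by simpa using projNorm_smul_le (p := p) (n := n) (0 : ℝ) (0 : Fin n → E))
        ((injNorm_nonneg _).trans (injNorm_le_projNorm _)))
      projNorm_add_le projNorm_smul_le)
    (fun n a x => le_antisymm
      (by
        have h := projNorm_le_of_repr (fun _ : Fin 1 => a) (fun _ : Fin 1 => x)
        rw [Fin.sum_univ_one, Fin.sum_univ_one] at h
        exact h)
      ((injNorm_tmul a x).symm.le.trans (injNorm_le_projNorm _)))
    (fun _ _ T u => projNorm_tensorId_le T u)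

section

variable {p : ℝ≥0∞} [Fact (1 ≤ p)]
  {X : Type*} [NormedAddCommGroup X] [NormedSpace ℝ X]
  {Y : Type*} [NormedAddCommGroup Y] [NormedSpace ℝ Y]

/-- The `p`-norm `‖u‖_p = sup_n ‖I ⊗ u : ℓ^p_n ⊗ X → ℓ^p_n ⊗ Y‖ ∈ [0, ∞]` of a linear map between
`p`-multinormed spaces. The operator `I ⊗ u` acts coordinatewise. -/
noncomputable def pNorm (α : PMultinorm p X) (β : PMultinorm p Y) (u : X →ₗ[ℝ] Y) : ℝ≥0∞ :=
  ⨆ (n : ℕ) (x : Fin n → X) (_ : α.norm n x ≤ 1), ENNReal.ofReal (β.norm n fun i => u (x i))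

/-- `u` is `p`-multibounded: its `p`-norm is finite. -/
def IsMultibounded (α : PMultinorm p X) (β : PMultinorm p Y) (u : X →ₗ[ℝ] Y) : Prop :=
  pNorm α β u < ∞

/-- `q` is a `p`-quotient map: for every `n`, the map `I ⊗ q : ℓ^p_n ⊗ X → ℓ^p_n ⊗ Y` is a
quotient map of normed spaces, i.e. it maps the open unit ball onto the open unit ball. -/
def IsPQuotientMap (α : PMultinorm p X) (β : PMultinorm p Y) (q : X →ₗ[ℝ] Y) : Prop :=
  ∀ n : ℕ, (fun (x : Fin n → X) (i : Fin n) => q (x i)) '' {x | α.norm n x < 1} =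
    {y | β.norm n y < 1}

/-- `(Y, β)` contains a copy of `(X, α)`: there are a subspace `V` of `Y` and a linear bijection
`X → V` which is `p`-multibounded and whose inverse is `p`-multibounded. -/
def ContainsCopy (α : PMultinorm p X) (β : PMultinorm p Y) : Prop :=
  ∃ (V : Submodule ℝ Y) (e : X ≃ₗ[ℝ] V),
    IsMultibounded α (β.restrict V) e.toLinearMap ∧
    IsMultibounded (β.restrict V) α e.symm.toLinearMap

end

/-- `(Z, γ)` is `1`-projective: for every `p`-quotient map `q : Y → X` of `p`-multinormed (Banach)
spaces, every `p`-multibounded `u : Z → X` and every `ε > 0`, there is a lifting `v : Z → Y` of `u`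
along `q` with `‖v‖_p ≤ ‖u‖_p + ε`. -/
def IsOneProjective {p : ℝ≥0∞} [Fact (1 ≤ p)] {Z : Type w} [NormedAddCommGroup Z]
    [NormedSpace ℝ Z] (γ : PMultinorm p Z) : Prop :=
  ∀ (Y : Type w) [NormedAddCommGroup Y] [NormedSpace ℝ Y] [CompleteSpace Y]
    (X : Type w) [NormedAddCommGroup X] [NormedSpace ℝ X] [CompleteSpace X]
    (β : PMultinorm p Y) (α : PMultinorm p X) (q : Y →ₗ[ℝ] X) (u : Z →ₗ[ℝ] X) (ε : ℝ),
    IsPQuotientMap β α q → IsMultibounded γ α u → 0 < ε →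
      ∃ v : Z →ₗ[ℝ] Y, pNorm γ β v ≤ pNorm γ α u + ENNReal.ofReal ε ∧ q ∘ₗ v = u

/-! ### Elementary estimates for multinorms and multibounded maps -/

section Multinorm

variable {p : ℝ≥0∞} [Fact (1 ≤ p)]
  {X : Type*} [NormedAddCommGroup X] [NormedSpace ℝ X]
  {Y : Type*} [NormedAddCommGroup Y] [NormedSpace ℝ Y]

/-! Everything rests on reading a tensor `u ∈ ℓ^p_n ⊗ Z` as an operator `(ℓ^p_n)^* → Z`. By
tensoriality its `p`-norm on `min_p((ℓ^p_n)^*)` is at most `‖u‖`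
(`PMultinorm.norm_dual_pairing_le`), and `u` is recovered as the image of the identity tensor, whose
injective norm is at most `1`. To lift such an operator along a `p`-quotient map it is enough to
lift one tensor, so `min_p((ℓ^p_n)^*)` is `1`-projective. Also, every multinormed Banach space `Z`
is a `p`-quotient of an `ℓ^1`-sum of such duals, one for each element of the unit balls of the
`ℓ^p_n ⊗ Z`.

If `Z` is `1`-projective, its identity lifts to this cover, and `Z` embeds there with bounds uniform
in `n`. The summands are finite dimensional, so a gliding hump in an infinite-dimensional subspace
yields unit images close to disjointly supported blocks `b_k`. In an `ℓ^1`-sum the cross-norm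
property gives `‖∑ a_k ⊗ b_k‖ = ∑ ‖a_k‖ ‖b_k‖`, which is comparable to the projective norm on `ℓ^p_n
⊗ ℓ^1`. The perturbation is harmless because the projective norm dominates all others, and for the
same reason the upper bound is automatic (`IsOneProjective.containsCopy`).

If `min_p(L^{p'}(μ))` were `1`-projective and infinite dimensional, `L^{p'}(μ)` would therefore
contain `ℓ^1`. For `1 < p' < ∞` this fails: with well-chosen signs, sums of `2^m` bounded vectors in
`L^{p'}` are exponentially smaller than `2^m`. Conversely, a finite-dimensional `L^{p'}(μ)` is
spanned by indicators of disjoint sets, so it is isometric to `ℓ^{p'}_m`, the dual of `ℓ^p_m`, and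
the first paragraph applies. -/

theorem pNorm_le_ofReal (α : PMultinorm p X) (β : PMultinorm p Y) (u : X →ₗ[ℝ] Y) {C : ℝ}
    (hC : 0 ≤ C) (h : ∀ n (x : Fin n → X), (β.norm n fun i => u (x i)) ≤ C * α.norm n x) :
    pNorm α β u ≤ ENNReal.ofReal C := by
  refine iSup_le fun n => iSup_le fun x => iSup_le fun hx => ENNReal.ofReal_le_ofReal ?_
  exact (h n x).trans (mul_le_of_le_one_right hC hx)

theorem isMultibounded_of_le (α : PMultinorm p X) (β : PMultinorm p Y) (u : X →ₗ[ℝ] Y) {C : ℝ}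
    (hC : 0 ≤ C) (h : ∀ n (x : Fin n → X), (β.norm n fun i => u (x i)) ≤ C * α.norm n x) :
    IsMultibounded α β u :=
  (pNorm_le_ofReal α β u hC h).trans_lt ENNReal.ofReal_lt_top

theorem IsMultibounded.norm_le {α : PMultinorm p X} {β : PMultinorm p Y} {u : X →ₗ[ℝ] Y}
    (h : IsMultibounded α β u) (n : ℕ) (x : Fin n → X) :
    (β.norm n fun i => u (x i)) ≤ (pNorm α β u).toReal * α.norm n x := by
  have key : ∀ y : Fin n → X, α.norm n y ≤ 1 →
      (β.norm n fun i => u (y i)) ≤ (pNorm α β u).toReal := fun y hy => by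
    rw [← ENNReal.ofReal_le_iff_le_toReal h.ne]
    exact le_iSup_of_le n (le_iSup_of_le y (le_iSup_of_le hy le_rfl))
  rcases eq_or_ne (α.norm n x) 0 with h0 | h0
  · have hx := α.eq_zero x h0
    subst hx
    have h1 : (fun i => u ((0 : Fin n → X) i)) = 0 := by ext; simp
    rw [h1, h0, map_zero, mul_zero]
  · have hpos : 0 < α.norm n x := lt_of_le_of_ne (apply_nonneg _ _) (Ne.symm h0)
    have h1 := key ((α.norm n x)⁻¹ • x) (by
      rw [map_smul_eq_mul, Real.norm_of_nonneg (inv_nonneg.2 hpos.le), inv_mul_cancel₀ h0])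
    have h2 : (fun i => u (((α.norm n x)⁻¹ • x) i)) = (α.norm n x)⁻¹ • fun i => u (x i) := by
      funext i; simp
    rw [h2, map_smul_eq_mul, Real.norm_of_nonneg (inv_nonneg.2 hpos.le),
      inv_mul_le_iff₀ hpos] at h1
    linarith

namespace PMultinorm

/-- On `ℓ^p_1 ⊗ X = X` every multinorm is the norm of `X`. -/
theorem norm_fin_one (α : PMultinorm p X) (x : X) : α.norm 1 (fun _ => x) = ‖x‖ := by
  have h := α.cross 1 (PiLp.single p 0 1) x
  rw [PiLp.norm_single] at h
  have h2 : (fun i : Fin 1 => (PiLp.single p 0 (1 : ℝ) : SeqLp p 1) i • x) = fun _ => x := by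
    funext i
    simp [Subsingleton.elim i 0]
  rw [h2] at h
  simpa using h

theorem norm_sum_le (α : PMultinorm p X) {n k : ℕ} (x : Fin k → Fin n → X) :
    α.norm n (∑ j, x j) ≤ ∑ j, α.norm n (x j) :=
  Finset.le_sum_of_subadditive _ (map_zero _).le (map_add_le_add _) _ _

/-- Maximality of `max_p`: the triangle inequality and the cross-norm property bound any multinorm
by the cost of a representation. Thus a bounded operator out of `max_p(X)` is automatically
multibounded. -/
theorem norm_le_projNorm (β : PMultinorm p Y) (T : X →ₗ[ℝ] Y) {C : ℝ} (hC : 0 ≤ C)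
    (hT : ∀ x, ‖T x‖ ≤ C * ‖x‖) {n : ℕ} (x : Fin n → X) :
    (β.norm n fun i => T (x i)) ≤ C * projNorm p n x := by
  have key : ∀ (k : ℕ) (a : Fin k → SeqLp p n) (e : Fin k → X),
      x = (∑ j, fun i => a j i • e j) →
        (β.norm n fun i => T (x i)) ≤ C * ∑ j, ‖a j‖ * ‖e j‖ := by
    intro k a e hx
    have h1 : (fun i => T (x i)) = ∑ j, fun i => a j i • T (e j) := by
      funext i
      rw [hx]
      simp [Finset.sum_apply]
    rw [h1, Finset.mul_sum]
    refine (β.norm_sum_le _).trans (Finset.sum_le_sum fun j _ => ?_)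
    rw [β.cross]
    calc ‖a j‖ * ‖T (e j)‖ ≤ ‖a j‖ * (C * ‖e j‖) :=
          mul_le_mul_of_nonneg_left (hT _) (norm_nonneg _)
      _ = _ := by ring
  rcases hC.eq_or_lt with rfl | hC
  · simpa using key n _ _ (exists_repr (p := p) x)
  · rw [← div_le_iff₀' hC]
    exact le_projNorm x _ fun k a e hx => by rw [div_le_iff₀' hC]; exact key k a e hx

/-- A crude bound, not uniform in `n`; for fixed `n` it turns coordinatewise convergence into
convergence in `ℓ^p_n ⊗ Y`. -/
theorem norm_le_sum (β : PMultinorm p Y) {n : ℕ} (y : Fin n → Y) :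
    β.norm n y ≤ ∑ i, ‖y i‖ := by
  conv_lhs => rw [exists_repr (p := p) y]
  refine (β.norm_sum_le _).trans (Finset.sum_le_sum fun j _ => ?_)
  rw [β.cross, PiLp.norm_single, norm_one, one_mul]

end PMultinorm

end Multinorm

/-! ### Operators on `ℓ^1`-sums -/

section LpOne

theorem lp.hasSum_norm_one {I : Type*} {E : I → Type*} [∀ i, NormedAddCommGroup (E i)] (y : lp E 1) : HasSum (fun i => ‖y i‖) ‖y‖ := by
  simpa using lp.hasSum_norm (by simp) y

variable {I : Type*} {E : I → Type*} [∀ i, NormedAddCommGroup (E i)] [∀ i, NormedSpace ℝ (E i)]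
  {Z : Type*} [NormedAddCommGroup Z] [NormedSpace ℝ Z]

/-- The operator on an `ℓ^1`-sum with given uniformly bounded restrictions to the summands. -/
theorem lp.exists_clm_hasSum [CompleteSpace Z] (φ : ∀ i, E i →L[ℝ] Z) {C : ℝ}
    (hφ : ∀ i x, ‖φ i x‖ ≤ C * ‖x‖) :
    ∃ T : lp E 1 →L[ℝ] Z, (∀ y, HasSum (fun i => φ i (y i)) (T y)) ∧ ∀ y, ‖T y‖ ≤ C * ‖y‖ := by
  have hb : ∀ y : lp E 1, HasSum (fun i => C * ‖y i‖) (C * ‖y‖) := fun y =>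
    (lp.hasSum_norm_one y).mul_left C
  have hs : ∀ y : lp E 1, HasSum (fun i => φ i (y i)) (∑' i, φ i (y i)) := fun y =>
    (Summable.of_norm_bounded (hb y).summable fun i => hφ i _).hasSum
  let T : lp E 1 →ₗ[ℝ] Z :=
    { toFun := fun y => ∑' i, φ i (y i)
      map_add' := fun x y => by
        refine (hs (x + y)).unique (((hs x).add (hs y)).congr_fun ?_)
        intro i
        simp
      map_smul' := fun c x => by
        refine (hs (c • x)).unique (((hs x).const_smul c).congr_fun ?_)
        intro i
        simp }
  have hT : ∀ y, ‖T y‖ ≤ C * ‖y‖ := fun y =>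
    tsum_of_norm_bounded (hb y) fun i => hφ i _
  exact ⟨T.mkContinuous C hT, hs, hT⟩

theorem lp.map_single_of_hasSum [DecidableEq I] {φ : ∀ i, E i →L[ℝ] Z} {T : lp E 1 → Z}
    (hT : ∀ y, HasSum (fun i => φ i (y i)) (T y)) (i : I) (x : E i) :
    T (lp.single 1 i x) = φ i x := by
  refine (hT _).unique ?_
  have h := hasSum_single (f := fun k => φ k ((lp.single 1 i x : lp E 1) k)) i fun k hk => by
    rw [lp.single_apply_ne 1 i x hk, map_zero]
  rwa [lp.single_apply_self] at h

end LpOne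

/-! ### Multinorms on `ℓ^1`-sums -/

section Sum

variable {p : ℝ≥0∞} [Fact (1 ≤ p)] {I : Type*} {E : I → Type*} [∀ i, NormedAddCommGroup (E i)]
  [∀ i, NormedSpace ℝ (E i)]

namespace PMultinorm

theorem summable_norm_lp (α : ∀ i, PMultinorm p (E i)) {n : ℕ} (y : Fin n → lp E 1) :
    Summable fun i => (α i).norm n fun j => y j i :=
  Summable.of_nonneg_of_le (fun _ => apply_nonneg _ _) (fun i => (α i).norm_le_sum _)
    (summable_sum fun j _ => (lp.hasSum_norm_one (y j)).summable)

/-- The `ℓ^1`-sum of `p`-multinormed spaces. -/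
noncomputable def lpOneSum (α : ∀ i, PMultinorm p (E i)) : PMultinorm p (lp E 1) :=
  ofTensorial
    (fun n => Seminorm.ofSMulLE (fun y => ∑' i, (α i).norm n fun j => y j i)
      (by
        have h : ∀ i, ((α i).norm n fun j => (0 : Fin n → lp E 1) j i) = 0 := fun i =>
          map_zero ((α i).norm n)
        exact (tsum_congr h).trans tsum_zero)
      (fun x y => by
        rw [← (summable_norm_lp α x).tsum_add (summable_norm_lp α y)]
        exact (summable_norm_lp α _).tsum_le_tsum (fun i => map_add_le_add ((α i).norm n) _ _)
          ((summable_norm_lp α x).add (summable_norm_lp α y)))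
      (fun c x => by
        rw [← tsum_mul_left]
        exact (summable_norm_lp α _).tsum_le_tsum
          (fun i => (map_smul_eq_mul ((α i).norm n) c _).le) ((summable_norm_lp α x).mul_left _)))
    (fun n a x => by
      change ∑' i, ((α i).norm n fun j => a j • x i) = _
      simp_rw [(α _).cross]
      rw [tsum_mul_left, (lp.hasSum_norm_one x).tsum_eq])
    (fun n m T u => by
      change ∑' i, ((α i).norm m fun j => tensorId T u j i) ≤ ‖T‖ * ∑' i, _
      rw [← tsum_mul_left]
      refine (summable_norm_lp α _).tsum_le_tsum (fun i => ?_)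
        ((summable_norm_lp α u).mul_left _)
      refine le_trans (le_of_eq ?_) ((α i).tensorial n m T _)
      congr 1
      funext j
      simp only [tensorId, lp.coeFn_sum, Finset.sum_apply, lp.coeFn_smul, Pi.smul_apply])

theorem hasSum_lpOneSum (α : ∀ i, PMultinorm p (E i)) {n : ℕ} (y : Fin n → lp E 1) :
    HasSum (fun i => (α i).norm n fun j => y j i) ((lpOneSum α).norm n y) :=
  (summable_norm_lp α y).hasSum

theorem lpOneSum_single [DecidableEq I] (α : ∀ i, PMultinorm p (E i)) {n : ℕ} (i : I)
    (d : Fin n → E i) :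
    ((lpOneSum α).norm n fun j => lp.single 1 i (d j)) = (α i).norm n d := by
  refine (hasSum_lpOneSum α _).unique ?_
  have h := hasSum_single
    (f := fun k => (α k).norm n fun j => (lp.single 1 i (d j) : lp E 1) k) i fun k hk => by
      simp_rw [lp.single_apply_ne 1 i _ hk]
      exact map_zero _
  simpa only [lp.single_apply_self] using h

end PMultinorm

end Sum

/-! ### Tensors as operators on the dual of `ℓ^p_n` -/

section Dual

variable {p : ℝ≥0∞} [Fact (1 ≤ p)]

/-- The operator `ℓ^p_n → ℓ^p_m` with given coordinate functionals. -/
noncomputable def SeqLp.ofCoords {n m : ℕ} (f : Fin m → SeqLp p n →L[ℝ] ℝ) :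
    SeqLp p n →L[ℝ] SeqLp p m :=
  ((PiLp.continuousLinearEquiv p ℝ fun _ : Fin m => ℝ).symm : (Fin m → ℝ) →L[ℝ] SeqLp p m).comp
    (ContinuousLinearMap.pi f)

theorem SeqLp.ofCoords_apply {n m : ℕ} (f : Fin m → SeqLp p n →L[ℝ] ℝ) (a : SeqLp p n)
    (k : Fin m) : SeqLp.ofCoords f a k = f k a := rfl

/-- An operator into `ℓ^p_m` is a tensor in `ℓ^p_m ⊗ (ℓ^p_n)^*`. Its value at `a` is normed by some
`b`, and pairing with `b` and evaluation at `a / ‖a‖` is one of the competitors in the injective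
norm. -/
theorem SeqLp.norm_ofCoords_le {n m : ℕ} (f : Fin m → SeqLp p n →L[ℝ] ℝ) :
    ‖SeqLp.ofCoords f‖ ≤ injNorm p m f := by
  refine ContinuousLinearMap.opNorm_le_bound _ (injNorm_nonneg _) fun a => ?_
  obtain ⟨b, hb, hba⟩ := exists_norming (SeqLp.ofCoords f a)
  have h1 : b (SeqLp.ofCoords f a) =
      tensorPair b (ContinuousLinearMap.apply ℝ ℝ a) f := by
    rw [SeqLp.map_eq_sum b]
    exact Finset.sum_congr rfl fun k _ => by
      rw [SeqLp.ofCoords_apply, smul_eq_mul, mul_comm]; rfl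
  rcases eq_or_ne a 0 with rfl | ha
  · simp
  have ha' : 0 < ‖a‖ := norm_pos_iff.2 ha
  have h2 := tensorPair_le_injNorm b (‖a‖⁻¹ • ContinuousLinearMap.apply ℝ ℝ a) hb (by
    rw [norm_smul, norm_inv, norm_norm, inv_mul_le_one₀ ha']
    exact ContinuousLinearMap.opNorm_le_bound _ (norm_nonneg _) fun g => by
      rw [mul_comm]; exact g.le_opNorm a) f
  have h3 : tensorPair b (‖a‖⁻¹ • ContinuousLinearMap.apply ℝ ℝ a) f =
      ‖a‖⁻¹ * tensorPair b (ContinuousLinearMap.apply ℝ ℝ a) f := by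
    simp only [tensorPair, Finset.mul_sum, smul_apply, smul_eq_mul]
    exact Finset.sum_congr rfl fun i _ => by ring
  rw [h3, ← h1, hba, abs_of_nonneg (by positivity), inv_mul_le_iff₀ ha', mul_comm] at h2
  exact h2

/-- The coordinate functionals form the identity tensor in `ℓ^p_n ⊗ (ℓ^p_n)^*`; pairing it with `b ⊗
F` gives `F b`. -/
theorem injNorm_proj_le {n : ℕ} :
    injNorm p n (fun j => (PiLp.proj p (fun _ : Fin n => ℝ) j : SeqLp p n →L[ℝ] ℝ)) ≤ 1 := by
  refine injNorm_le _ _ fun b F hb hF => ?_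
  have h : tensorPair b F (fun j => (PiLp.proj p (fun _ : Fin n => ℝ) j : SeqLp p n →L[ℝ] ℝ)) =
      F b := by
    have hb' : b = ∑ i, b (PiLp.single p i 1) •
        (PiLp.proj p (fun _ : Fin n => ℝ) i : SeqLp p n →L[ℝ] ℝ) := by
      ext a
      rw [SeqLp.map_eq_sum b a]
      simp [mul_comm]
    conv_rhs => rw [hb']
    simp [tensorPair, map_sum]
  rw [h, ← Real.norm_eq_abs]
  exact (F.le_of_opNorm_le hF b).trans (by simpa using hb)

/-- The tensorial axiom read backwards: with `u` fixed and the operator varying, it says that `f ↦ ∑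
f(δ_j) u_j` has `p`-norm at most `‖u‖` on `min_p((ℓ^p_n)^*)`. -/
theorem PMultinorm.norm_dual_pairing_le {Z : Type*} [NormedAddCommGroup Z] [NormedSpace ℝ Z]
    (β : PMultinorm p Z) {n m : ℕ} (f : Fin m → SeqLp p n →L[ℝ] ℝ) (u : Fin n → Z) :
    (β.norm m fun k => ∑ j, f k (PiLp.single p j 1) • u j) ≤ injNorm p m f * β.norm n u :=
  (β.tensorial n m (SeqLp.ofCoords f) u).trans
    (mul_le_mul_of_nonneg_right (SeqLp.norm_ofCoords_le f) (apply_nonneg _ _))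

theorem injNorm_comp_le {X Y : Type*} [NormedAddCommGroup X] [NormedSpace ℝ X]
    [NormedAddCommGroup Y] [NormedSpace ℝ Y] (T : X →L[ℝ] Y) (hT : ‖T‖ ≤ 1) {n : ℕ}
    (x : Fin n → X) : injNorm p n (fun i => T (x i)) ≤ injNorm p n x :=
  injNorm_le _ _ fun a f ha hf =>
    tensorPair_le_injNorm a (f.comp T) ha
      ((f.opNorm_comp_le T).trans (mul_le_one₀ hf (norm_nonneg _) hT)) x

theorem injNorm_one {X : Type*} [NormedAddCommGroup X] [NormedSpace ℝ X] (x : X) :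
    injNorm p 1 (fun _ => x) = ‖x‖ :=
  (minMultinorm p X).norm_fin_one x

/-- The injective structure on a space isometric to the dual of `ℓ^p_m` is `1`-projective. -/
theorem isOneProjective_min_of_dual {m : ℕ} {E : Type w} [NormedAddCommGroup E] [NormedSpace ℝ E]
    (J : (SeqLp p m →L[ℝ] ℝ) ≃ₗᵢ[ℝ] E) : IsOneProjective (minMultinorm p E) := by
  intro Y _ _ _ X _ _ _ β α q u ε hq hu hε
  -- The identity tensor transported to `E`; a linear map out of `E` is determined by its image of
  -- this single tensor.
  let e : Fin m → E := fun j => J (PiLp.proj p (fun _ : Fin m => ℝ) j)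
  have he : injNorm p m e ≤ 1 :=
    (injNorm_comp_le (J : (SeqLp p m →L[ℝ] ℝ) →L[ℝ] E)
      J.toLinearIsometry.norm_toContinuousLinearMap_le _).trans injNorm_proj_le
  have hC : 0 ≤ (pNorm (minMultinorm p E) α u).toReal := ENNReal.toReal_nonneg
  set C := (pNorm (minMultinorm p E) α u).toReal with hCdef
  have hue : (α.norm m fun j => u (e j)) < C + ε := by
    refine (hu.norm_le m e).trans_lt ?_
    have h1 : C * injNorm p m e ≤ C := mul_le_of_le_one_right hC he
    exact h1.trans_lt (lt_add_of_pos_right C hε)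
  have hCε : 0 < C + ε := by positivity
  -- The extra `ε` makes the inequality strict, so the rescaled image lies in the open ball and the
  -- quotient property provides a preimage `y`.
  have hmem : (C + ε)⁻¹ • (fun j => u (e j)) ∈ {y | α.norm m y < 1} := by
    rw [Set.mem_ofPred_eq, map_smul_eq_mul, Real.norm_of_nonneg (inv_nonneg.2 hCε.le),
      inv_mul_lt_iff₀ hCε]
    simpa using hue
  rw [← hq m] at hmem
  obtain ⟨y, hy, hqy⟩ := hmem
  have hy1 : β.norm m ((C + ε) • y) ≤ C + ε := by
    rw [map_smul_eq_mul, Real.norm_of_nonneg hCε.le]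
    exact mul_le_of_le_one_right hCε.le (le_of_lt hy)
  -- The lift is the operator represented by the lifted tensor.
  let v : E →ₗ[ℝ] Y :=
    { toFun := fun g => ∑ j, J.symm g (PiLp.single p j 1) • ((C + ε) • y) j
      map_add' := fun g h => by
        simp only [map_add, add_apply, add_smul _ _ (((C + ε) • y) _), Finset.sum_add_distrib]
      map_smul' := fun c g => by simp [Finset.smul_sum, mul_smul] }
  refine ⟨v, ?_, ?_⟩
  · have hle : pNorm (minMultinorm p E) β v ≤ ENNReal.ofReal (C + ε) := by
      refine pNorm_le_ofReal _ _ _ hCε.le fun n x => ?_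
      refine (β.norm_dual_pairing_le (fun k => J.symm (x k)) ((C + ε) • y)).trans ?_
      rw [mul_comm]
      refine mul_le_mul hy1 ?_ (injNorm_nonneg _) hCε.le
      exact injNorm_comp_le (J.symm : E →L[ℝ] (SeqLp p m →L[ℝ] ℝ))
        J.symm.toLinearIsometry.norm_toContinuousLinearMap_le _
    rwa [ENNReal.ofReal_add hC hε.le, hCdef, ENNReal.ofReal_toReal hu.ne] at hle
  · ext g
    have h1 : ∀ j, q (((C + ε) • y) j) = u (e j) := fun j => by
      have h := congrFun hqy j
      simp only [Pi.smul_apply, map_smul] at h ⊢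
      rw [h, smul_inv_smul₀ hCε.ne']
    have h2 : g = ∑ j, J.symm g (PiLp.single p j 1) • e j := by
      apply J.symm.injective
      ext a
      rw [SeqLp.map_eq_sum (J.symm g) a]
      simp [e, mul_comm]
    conv_rhs => rw [h2]
    simp only [LinearMap.comp_apply, v, LinearMap.coe_mk, AddHom.coe_mk, map_sum, map_smul, h1]

end Dual

/-! ### Every multinormed Banach space as a quotient of an `ℓ^1`-sum of duals -/

section Cover

variable {p : ℝ≥0∞} [Fact (1 ≤ p)] {Z : Type w} [NormedAddCommGroup Z] [NormedSpace ℝ Z]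

/-- The infinite triangle inequality: for fixed `n` the tail is controlled by the sum of its
coordinate norms, so coordinatewise convergence suffices. -/
theorem PMultinorm.norm_le_of_hasSum (α : PMultinorm p Z) {I : Type*} {n : ℕ}
    {F : I → Fin n → Z} {z : Fin n → Z} {s : ℝ} (hz : ∀ j, HasSum (fun i => F i j) (z j))
    (hs : HasSum (fun i => α.norm n (F i)) s) : α.norm n z ≤ s := by
  have h1 : Filter.Tendsto (fun S : Finset I => s + ∑ j, ‖z j - ∑ i ∈ S, F i j‖) Filter.atTop
      (nhds (s + ∑ j : Fin n, ‖z j - z j‖)) :=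
    tendsto_const_nhds.add (tendsto_finsetSum _ fun j _ => (tendsto_const_nhds.sub (hz j)).norm)
  simp only [sub_self, norm_zero, Finset.sum_const_zero, add_zero] at h1
  refine ge_of_tendsto' h1 fun S => ?_
  have h2 : z = ∑ i ∈ S, F i + fun j => z j - ∑ i ∈ S, F i j := by
    funext j; simp
  calc α.norm n z ≤ α.norm n (∑ i ∈ S, F i) + α.norm n (fun j => z j - ∑ i ∈ S, F i j) := by
        conv_lhs => rw [h2]
        exact map_add_le_add _ _ _
    _ ≤ _ := by
        refine add_le_add ?_ (α.norm_le_sum _)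
        refine (Finset.le_sum_of_subadditive _ (map_zero _).le (map_add_le_add _) _ _).trans ?_
        exact sum_le_hasSum S (fun i _ => apply_nonneg _ _) hs

/-- The union over `n` of the closed unit balls of `ℓ^p_n ⊗ Z`. -/
abbrev PMultinorm.Ball (γ : PMultinorm p Z) : Type w :=
  Σ n : ℕ, {z : Fin n → Z // γ.norm n z ≤ 1}

/-- The `ℓ^1`-sum of copies of the duals of `ℓ^p_n`, one for each element of the unit balls. -/
abbrev PMultinorm.Cover (γ : PMultinorm p Z) : Type w :=
  lp (fun i : γ.Ball => SeqLp p i.1 →L[ℝ] ℝ) 1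

/-- The multinorm structure of the cover: the `ℓ^1`-sum of the minimal structures. -/
noncomputable abbrev PMultinorm.cover (γ : PMultinorm p Z) : PMultinorm p γ.Cover :=
  PMultinorm.lpOneSum fun i : γ.Ball => minMultinorm p (SeqLp p i.1 →L[ℝ] ℝ)

/-- On each summand the map is the operator represented by the indexing ball element, a contraction
at every level; contractions add up on an `ℓ^1`-sum. Every ball element is hit by the identity
tensor of its own summand. -/
theorem PMultinorm.exists_pQuotient_cover [CompleteSpace Z] (γ : PMultinorm p Z) :
    ∃ q : γ.Cover →ₗ[ℝ] Z, (∀ n y, (γ.norm n fun i => q (y i)) ≤ γ.cover.norm n y) ∧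
      IsPQuotientMap γ.cover γ q := by
  classical
  let φ : ∀ i : γ.Ball, (SeqLp p i.1 →L[ℝ] ℝ) →L[ℝ] Z := fun i =>
    ∑ j, (ContinuousLinearMap.apply ℝ ℝ (PiLp.single p j 1 : SeqLp p i.1)).smulRight (i.2.1 j)
  have hφ : ∀ i f, φ i f = ∑ j, f (PiLp.single p j 1) • i.2.1 j := fun i f => by
    simp [φ]
  have hφn : ∀ (i : γ.Ball) (n : ℕ) (f : Fin n → SeqLp p i.1 →L[ℝ] ℝ),
      (γ.norm n fun k => φ i (f k)) ≤ injNorm p n f := fun i n f => by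
    simp only [hφ]
    exact (γ.norm_dual_pairing_le f i.2.1).trans
      (mul_le_of_le_one_right (injNorm_nonneg _) i.2.2)
  obtain ⟨q, hq, -⟩ := lp.exists_clm_hasSum φ (C := 1) fun i f => by
    have h := hφn i 1 fun _ => f
    rwa [γ.norm_fin_one, injNorm_one, ← one_mul ‖f‖] at h
  have hle : ∀ n y, (γ.norm n fun i => q (y i)) ≤ γ.cover.norm n y := fun n y => by
    have hs := PMultinorm.hasSum_lpOneSum
      (fun i : γ.Ball => minMultinorm p (SeqLp p i.1 →L[ℝ] ℝ)) y
    have hs' := Summable.of_nonneg_of_le (fun i => apply_nonneg (γ.norm n) _)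
      (fun i => hφn i n fun j => y j i) hs.summable
    refine (γ.norm_le_of_hasSum (fun j => hq (y j)) hs'.hasSum).trans ?_
    exact hasSum_le (fun i => hφn i n fun j => y j i) hs'.hasSum hs
  refine ⟨q, hle, fun n => Set.Subset.antisymm ?_ ?_⟩
  · rintro _ ⟨y, hy, rfl⟩
    exact (hle n y).trans_lt hy
  · intro z hz
    obtain ⟨c, hzc, hc⟩ := exists_between (show γ.norm n z < 1 from hz)
    have hc0 : 0 < c := (apply_nonneg (γ.norm n) z).trans_lt hzc
    -- With `‖z‖ < c < 1`, the tensor `z / c` is an admissible index, and `c` times the identity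
    -- tensor in that summand is a preimage of `z` of norm at most `c < 1`.
    let i : γ.Ball := ⟨n, c⁻¹ • z, by
      rw [map_smul_eq_mul, Real.norm_of_nonneg (inv_nonneg.2 hc0.le), inv_mul_le_iff₀ hc0]
      simpa using hzc.le⟩
    let d : Fin n → SeqLp p i.1 →L[ℝ] ℝ := fun j => PiLp.proj p (fun _ : Fin n => ℝ) j
    let y : Fin n → γ.Cover := fun j => lp.single 1 i (d j)
    have h2 : γ.cover.norm n y = injNorm p n d :=
      PMultinorm.lpOneSum_single
        (fun k : γ.Ball => minMultinorm p (SeqLp p k.1 →L[ℝ] ℝ)) (n := n) i d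
    have h1 : ∀ j, q (y j) = φ i (d j) := fun j => lp.map_single_of_hasSum hq i (d j)
    refine ⟨c • y, ?_, ?_⟩
    · rw [Set.mem_ofPred_eq, map_smul_eq_mul, h2, Real.norm_of_nonneg hc0.le]
      exact (mul_le_of_le_one_right hc0.le injNorm_proj_le).trans_lt hc
    · funext j
      simp only [Pi.smul_apply, map_smul, ContinuousLinearMap.coe_coe]
      rw [h1, hφ, Finset.sum_eq_single (j : Fin n)]
      · simp [d, i, hc0.ne']
      · intro k _ hk
        simp [d, hk]
      · simp

/-- A `1`-projective multinormed space embeds into an `ℓ^1`-sum of finite-dimensional spaces. -/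
theorem IsOneProjective.exists_embedding [CompleteSpace Z] {γ : PMultinorm p Z}
    (h : IsOneProjective γ) : ∃ v : Z →ₗ[ℝ] γ.Cover, IsMultibounded γ γ.cover v ∧
      ∀ n z, γ.norm n z ≤ γ.cover.norm n fun i => v (z i) := by
  obtain ⟨q, hle, hq⟩ := γ.exists_pQuotient_cover
  have hid : pNorm γ γ LinearMap.id ≤ ENNReal.ofReal 1 :=
    pNorm_le_ofReal _ _ _ zero_le_one fun n x => by simp
  -- Any `ε` would do: only boundedness of `v` matters. The lower bound comes from `q ∘ v = id` and
  -- the contractivity of `q`.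
  obtain ⟨v, hv, hqv⟩ := h γ.Cover Z γ.cover γ q LinearMap.id 1 hq
    (hid.trans_lt ENNReal.ofReal_lt_top) one_pos
  refine ⟨v, hv.trans_lt ?_, fun n z => ?_⟩
  · exact ENNReal.add_lt_top.2 ⟨hid.trans_lt ENNReal.ofReal_lt_top, ENNReal.ofReal_lt_top⟩
  · have := hle n fun i => v (z i)
    simpa only [← LinearMap.comp_apply, hqv, LinearMap.id_apply] using this

end Cover

/-! ### Gliding hump and copies of `max_p(ℓ^1)` -/

section GlidingHump

variable {I : Type*} {E : I → Type*} [∀ i, NormedAddCommGroup (E i)] [∀ i, NormedSpace ℝ (E i)]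

theorem exists_norm_one_vanishing_on_finset [∀ i, FiniteDimensional ℝ (E i)] {W : Type*}
    [AddCommGroup W] [Module ℝ W] (hW : ¬ FiniteDimensional ℝ W) (v : W →ₗ[ℝ] lp E 1)
    (hv : Function.Injective v) (F : Finset I) :
    ∃ x : W, ‖v x‖ = 1 ∧ ∀ i ∈ F, v x i = 0 := by
  -- Restriction to the coordinates in `F` has finite-dimensional target, so it has a nontrivial
  -- kernel on `W`.
  let P : W →ₗ[ℝ] ∀ i : F, E i := LinearMap.pi fun i => (lp.evalₗ (𝕜 := ℝ) E 1 (i : I)) ∘ₗ v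
  have hP : ¬ Function.Injective P := fun h => hW (Module.Finite.of_injective P h)
  rw [← LinearMap.ker_eq_bot, Submodule.eq_bot_iff] at hP
  push Not at hP
  obtain ⟨x, hx, hx0⟩ := hP
  have hvx : ‖v x‖ ≠ 0 := by
    rw [norm_ne_zero_iff]
    exact fun h => hx0 (hv (h.trans (map_zero v).symm))
  refine ⟨‖v x‖⁻¹ • x, ?_, fun i hi => ?_⟩
  · rw [map_smul, norm_smul, norm_inv, norm_norm, inv_mul_cancel₀ hvx]
  · have h := congrFun (LinearMap.mem_ker.1 hx) ⟨i, hi⟩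
    have h' : v x i = 0 := h
    rw [map_smul, lp.coeFn_smul, Pi.smul_apply, h', smul_zero]

/-- Alternately choose a unit image vanishing on the current finite set, and enlarge that set until
it carries the image up to `δ`. Truncated to `F (k + 1)`, the `k`-th image lives on the increment `F
(k + 1) \ F k`, and these increments are disjoint. -/
theorem exists_gliding_hump [DecidableEq I] [∀ i, FiniteDimensional ℝ (E i)] {W : Type*}
    [AddCommGroup W] [Module ℝ W] (hW : ¬ FiniteDimensional ℝ W) (v : W →ₗ[ℝ] lp E 1)
    (hv : Function.Injective v) {δ : ℝ} (hδ : 0 < δ) :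
    ∃ (x : ℕ → W) (F : ℕ → Finset I), Monotone F ∧ (∀ k, ‖v (x k)‖ = 1) ∧
      (∀ k, ∀ i ∈ F k, v (x k) i = 0) ∧
      ∀ k, ‖v (x k) - ∑ i ∈ F (k + 1), lp.single 1 i (v (x k) i)‖ ≤ δ := by
  choose g hg1 hg0 using exists_norm_one_vanishing_on_finset hW v hv
  have hex : ∀ F : Finset I, ∃ G : Finset I, F ⊆ G ∧
      ‖v (g F) - ∑ i ∈ G, lp.single 1 i (v (g F) i)‖ ≤ δ := fun F => by
    have h1 := (tendsto_const_nhds (x := v (g F))).sub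
      (lp.hasSum_single ENNReal.one_ne_top (v (g F)))
    have h2 := h1.norm
    rw [sub_self, norm_zero] at h2
    obtain ⟨G, hG1, hG2⟩ :=
      ((h2.eventually (Iic_mem_nhds hδ)).and (Filter.eventually_ge_atTop F)).exists
    exact ⟨G, hG2, hG1⟩
  choose h hh1 hh2 using hex
  let F : ℕ → Finset I := fun k => h^[k] ∅
  have hF : ∀ k, F (k + 1) = h (F k) := fun k => Function.iterate_succ_apply' h k ∅
  refine ⟨fun k => g (F k), F, monotone_nat_of_le_succ fun k => ?_, fun k => hg1 _,
    fun k => hg0 _, fun k => ?_⟩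
  · rw [hF]; exact hh1 _
  · rw [hF]; exact hh2 _

theorem Finset.sum_sdiff_range_le [DecidableEq I] {F : ℕ → Finset I} (hF : Monotone F) {t : I → ℝ}
    (ht : ∀ i, 0 ≤ t i) (N : ℕ) :
    ∑ k ∈ Finset.range N, ∑ i ∈ F (k + 1) \ F k, t i ≤ ∑ i ∈ F N, t i := by
  induction N with
  | zero => simpa using Finset.sum_nonneg fun i _ => ht i
  | succ N ih =>
    rw [Finset.sum_range_succ, ← Finset.sum_sdiff (hF (Nat.le_succ N))]
    linarith

variable {p : ℝ≥0∞} [Fact (1 ≤ p)]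

/-- The `k`-th coordinate of an element of `ℓ^p_n ⊗ ℓ^1`. -/
noncomputable def lpOneCoord (p : ℝ≥0∞) {n : ℕ} (x : Fin n → lp (fun _ : ℕ => ℝ) 1) (k : ℕ) :
    SeqLp p n :=
  WithLp.toLp p fun j => x j k

/-- The half of `ℓ^p_n ⊗_π ℓ^1 = ℓ^1(ℓ^p_n)` that is needed, in truncated form; for fixed `n` the
error term tends to `0` as `N → ∞`. -/
theorem projNorm_lpOne_le {n : ℕ} (x : Fin n → lp (fun _ : ℕ => ℝ) 1) (N : ℕ) :
    projNorm p n x ≤ ∑ k ∈ Finset.range N, ‖lpOneCoord p x k‖ +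
      ∑ j, ‖x j - ∑ k ∈ Finset.range N, lp.single 1 k (x j k)‖ := by
  let M := maxMultinorm p (lp (fun _ : ℕ => ℝ) 1)
  let s : ℕ → Fin n → lp (fun _ : ℕ => ℝ) 1 := fun k j => lpOneCoord p x k j • lp.single 1 k 1
  have hs : ∀ k j, s k j = lp.single 1 k (x j k) := fun k j => by
    simp only [s, lpOneCoord, ← lp.single_smul]
    simp
  have hsn : ∀ k, M.norm n (s k) = ‖lpOneCoord p x k‖ := fun k => by
    rw [M.cross, lp.norm_single one_pos, norm_one, mul_one]
  have hx : x = ∑ k ∈ Finset.range N, s k +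
      fun j => x j - ∑ k ∈ Finset.range N, lp.single 1 k (x j k) := by
    funext j
    simp only [Pi.add_apply, Finset.sum_apply, hs]
    abel
  change M.norm n x ≤ _
  conv_lhs => rw [hx]
  refine (map_add_le_add _ _ _).trans (add_le_add ?_ (M.norm_le_sum _))
  simp_rw [← hsn]
  exact Finset.le_sum_of_subadditive _ (map_zero _).le (map_add_le_add _) _ _

/-- At an index `i` of the `k`-th block only `b_k` contributes, so the tensor there is elementary
and its norm is `‖x_k‖ ‖b_k i‖`, with `x_k` the `k`-th coordinate. Summing over the block gives
`‖x_k‖ ‖b_k‖`, whatever the structures `α i` are. -/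
theorem PMultinorm.lpOneSum_block_lower_bound [DecidableEq I] (α : ∀ i, PMultinorm p (E i))
    {F : ℕ → Finset I} (hF : Monotone F) {b : ℕ → lp E 1} {c : ℝ} (hc : 0 ≤ c)
    (hb : ∀ k, c ≤ ‖b k‖) (hsupp : ∀ k i, i ∉ F (k + 1) \ F k → b k i = 0)
    {A : lp (fun _ : ℕ => ℝ) 1 → lp E 1} (hA : ∀ x, HasSum (fun k => x k • b k) (A x)) {n : ℕ}
    (x : Fin n → lp (fun _ : ℕ => ℝ) 1) :
    c * projNorm p n x ≤ (lpOneSum α).norm n fun j => A (x j) := by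
  have hdisj : ∀ {k l i}, i ∈ F (k + 1) \ F k → i ∈ F (l + 1) \ F l → l = k := by
    intro k l i hk hl
    rw [Finset.mem_sdiff] at hk hl
    rcases lt_trichotomy l k with h | h | h
    · exact absurd (hF h hl.1) hk.2
    · exact h
    · exact absurd (hF h hk.1) hl.2
  have hAi : ∀ k, ∀ i ∈ F (k + 1) \ F k, ∀ y, A y i = y k • b k i := by
    intro k i hi y
    have h1 := (hA y).mapL (lp.evalCLM ℝ E 1 i)
    refine h1.unique ?_
    refine hasSum_single k fun l hl => ?_
    have h0 : b l i = 0 := hsupp l i fun h => hl (hdisj hi h)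
    change (y l • b l) i = 0
    rw [lp.coeFn_smul, Pi.smul_apply, h0, smul_zero]
  have hnorm : ∀ k, ‖b k‖ = ∑ i ∈ F (k + 1) \ F k, ‖b k i‖ := fun k =>
    (lp.hasSum_norm_one (b k)).unique
      (hasSum_sum_of_ne_finset_zero fun i hi => by rw [hsupp k i hi, norm_zero])
  have hsum : ∀ N, c * ∑ k ∈ Finset.range N, ‖lpOneCoord p x k‖ ≤
      (lpOneSum α).norm n fun j => A (x j) := by
    intro N
    have h1 : ∀ k, ∀ i ∈ F (k + 1) \ F k,
        ((α i).norm n fun j => A (x j) i) = ‖lpOneCoord p x k‖ * ‖b k i‖ := fun k i hi => by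
      rw [← (α i).cross]
      congr 1
      funext j
      rw [hAi k i hi]
      rfl
    calc c * ∑ k ∈ Finset.range N, ‖lpOneCoord p x k‖
        ≤ ∑ k ∈ Finset.range N, ∑ i ∈ F (k + 1) \ F k, ((α i).norm n fun j => A (x j) i) := by
          rw [Finset.mul_sum]
          refine Finset.sum_le_sum fun k _ => ?_
          rw [Finset.sum_congr rfl (h1 k), ← Finset.mul_sum, ← hnorm, mul_comm]
          exact mul_le_mul_of_nonneg_left (hb k) (norm_nonneg _)
      _ ≤ ∑ i ∈ F N, ((α i).norm n fun j => A (x j) i) :=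
          Finset.sum_sdiff_range_le hF (fun i => apply_nonneg _ _) N
      _ ≤ _ := sum_le_hasSum _ (fun i _ => apply_nonneg _ _) (hasSum_lpOneSum α _)
  have ht : Filter.Tendsto (fun N : ℕ => ((lpOneSum α).norm n fun j => A (x j)) +
      c * ∑ j, ‖x j - ∑ k ∈ Finset.range N, lp.single 1 k (x j k)‖) Filter.atTop
      (nhds (((lpOneSum α).norm n fun j => A (x j)) + c * ∑ j : Fin n, ‖x j - x j‖)) :=
    tendsto_const_nhds.add ((tendsto_finsetSum _ fun j _ => (tendsto_const_nhds.sub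
      (lp.hasSum_single ENNReal.one_ne_top (x j)).tendsto_sum_nat).norm).const_mul c)
  simp only [sub_self, norm_zero, Finset.sum_const_zero, mul_zero, add_zero] at ht
  refine ge_of_tendsto' ht fun N => ?_
  refine (mul_le_mul_of_nonneg_left (projNorm_lpOne_le x N) hc).trans ?_
  rw [mul_add]
  linarith [hsum N]

theorem IsOneProjective.containsCopy {Z : Type w} [NormedAddCommGroup Z] [NormedSpace ℝ Z]
    [CompleteSpace Z] {γ : PMultinorm p Z} (h : IsOneProjective γ) {W : Submodule ℝ Z}
    (hWc : IsClosed (W : Set Z)) (hW : ¬ FiniteDimensional ℝ W) :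
    ContainsCopy (maxMultinorm p (lp (fun _ : ℕ => ℝ) 1)) (γ.restrict W) := by
  classical
  have : CompleteSpace W := hWc.completeSpace_coe
  obtain ⟨v, hv, hlow⟩ := h.exists_embedding
  set C := (pNorm γ γ.cover v).toReal with hCdef
  have hC : 0 ≤ C := ENNReal.toReal_nonneg
  have hup1 : ∀ z, ‖v z‖ ≤ C * ‖z‖ := fun z => by
    have := hv.norm_le 1 fun _ => z
    rwa [γ.norm_fin_one, γ.cover.norm_fin_one] at this
  have hlow1 : ∀ z, ‖z‖ ≤ ‖v z‖ := fun z => by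
    have := hlow 1 fun _ => z
    rwa [γ.norm_fin_one, γ.cover.norm_fin_one] at this
  have hinj : Function.Injective (v ∘ₗ W.subtype) := by
    rw [← LinearMap.ker_eq_bot, Submodule.eq_bot_iff]
    intro z hz
    have h1 := hlow1 z
    rw [show v z = 0 from hz, norm_zero] at h1
    exact Subtype.ext (norm_le_zero_iff.1 h1)
  obtain ⟨x, F, hF, hx1, hx0, hxt⟩ := exists_gliding_hump hW (v ∘ₗ W.subtype) hinj
    (δ := 1 / 4) (by norm_num)
  simp only [LinearMap.comp_apply, Submodule.subtype_apply] at hx1 hx0 hxt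
  -- Disjoint blocks `b k` of norm at least `3/4`, and remainders `r k` of norm at most `1/4`. The
  -- bound `2` on `‖b k‖` only serves to define `A`.
  let b : ℕ → γ.Cover := fun k => ∑ i ∈ F (k + 1), lp.single 1 i (v (x k) i)
  let r : ℕ → γ.Cover := fun k => v (x k) - b k
  have hr : ∀ k, ‖r k‖ ≤ 1 / 4 := hxt
  have hb1 : ∀ k, 3 / 4 ≤ ‖b k‖ := fun k => by
    have h1 := norm_sub_norm_le (v (x k)) (b k)
    linarith [hr k, hx1 k]
  have hb2 : ∀ k, ‖b k‖ ≤ 2 := fun k => by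
    have h1 := norm_sub_norm_le (b k) (v (x k))
    rw [norm_sub_rev] at h1
    linarith [hr k, hx1 k]
  have hsupp : ∀ k i, i ∉ F (k + 1) \ F k → b k i = 0 := by
    intro k i hi
    have h1 : b k i = ∑ l ∈ F (k + 1),
        (lp.single 1 l (v (x k) l) : γ.Cover) i := by
      simp only [b, lp.coeFn_sum, Finset.sum_apply]
    rw [h1]
    refine Finset.sum_eq_zero fun l hl => ?_
    rcases eq_or_ne i l with rfl | hil
    · rw [lp.single_apply_self]
      refine hx0 k i ?_
      by_contra h2
      exact hi (Finset.mem_sdiff.2 ⟨hl, h2⟩)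
    · exact lp.single_apply_ne 1 l _ hil
  have hop : ∀ {G : Type w} [NormedAddCommGroup G] [NormedSpace ℝ G] [CompleteSpace G]
      (g : ℕ → G) (D : ℝ), (∀ k, ‖g k‖ ≤ D) → ∃ T : lp (fun _ : ℕ => ℝ) 1 →L[ℝ] G,
        (∀ y, HasSum (fun k => y k • g k) (T y)) ∧ ∀ y, ‖T y‖ ≤ D * ‖y‖ := by
    intro G _ _ _ g D hg
    obtain ⟨T, hT1, hT2⟩ := lp.exists_clm_hasSum (E := fun _ : ℕ => ℝ)
      (fun k => (ContinuousLinearMap.id ℝ ℝ).smulRight (g k)) (C := D) fun k c => by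
        simp only [ContinuousLinearMap.smulRight_apply, ContinuousLinearMap.id_apply, norm_smul]
        rw [mul_comm]
        exact mul_le_mul_of_nonneg_right (hg k) (norm_nonneg _)
    exact ⟨T, hT1, hT2⟩
  -- The embedding sends the `k`-th unit vector of `ℓ^1` to `x k`; its image under `v` splits into
  -- the block part `A` and the small part `B`.
  obtain ⟨e, he, hen⟩ := hop x 1 fun k => (hlow1 (x k)).trans (hx1 k).le
  obtain ⟨A, hA, -⟩ := hop b 2 hb2
  obtain ⟨B, hB, hBn⟩ := hop r (1 / 4) hr
  let vc : Z →L[ℝ] γ.Cover := v.mkContinuous C hup1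
  have hdec : ∀ y, v (e y) = A y + B y := fun y => by
    have h1 := ((he y).mapL W.subtypeL).mapL vc
    refine h1.unique (((hA y).add (hB y)).congr_fun fun k => ?_)
    simp only [map_smul, r, ← smul_add, add_sub_cancel]
    rfl
  -- The block part is bounded below by `3/4` and the remainder above by `1/4` of the projective
  -- norm. The difference `1/2`, with `‖v‖_p ≤ C`, gives the factor `2 * C`.
  have hmain : ∀ n (y : Fin n → lp (fun _ : ℕ => ℝ) 1),
      projNorm p n y ≤ 2 * C * γ.norm n fun j => (e (y j) : Z) := by
    intro n y
    have h1 : 3 / 4 * projNorm p n y ≤ γ.cover.norm n fun j => A (y j) :=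
      PMultinorm.lpOneSum_block_lower_bound _ hF (by norm_num) hb1 hsupp hA y
    have h2 : (γ.cover.norm n fun j => B (y j)) ≤ 1 / 4 * projNorm p n y :=
      γ.cover.norm_le_projNorm B.toLinearMap (by norm_num) hBn y
    have h3 : (γ.cover.norm n fun j => A (y j)) ≤
        (γ.cover.norm n fun j => v (e (y j))) + γ.cover.norm n fun j => B (y j) := by
      have h4 : (fun j => A (y j)) = (fun j => v (e (y j))) - fun j => B (y j) := by
        funext j
        simp [hdec]
      rw [h4]
      exact map_sub_le_add _ _ _
    have h5 := hv.norm_le n fun j => (e (y j) : Z)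
    rw [← hCdef] at h5
    linarith
  have heinj : Function.Injective e := by
    rw [injective_iff_map_eq_zero]
    intro y hy
    have h1 := hmain 1 fun _ => y
    rw [hy, Submodule.coe_zero, γ.norm_fin_one, norm_zero, mul_zero] at h1
    have h2 : projNorm p 1 (fun _ => y) = ‖y‖ := (maxMultinorm p _).norm_fin_one y
    rw [h2] at h1
    exact norm_le_zero_iff.1 h1
  let e' := LinearEquiv.ofInjective e.toLinearMap heinj
  refine ⟨LinearMap.range e.toLinearMap, e', ?_, ?_⟩
  · exact isMultibounded_of_le _ _ _ zero_le_one fun n y =>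
      (γ.restrict W).norm_le_projNorm e.toLinearMap zero_le_one hen y
  · refine isMultibounded_of_le _ _ _ (C := 2 * C) (by positivity) fun n y => ?_
    refine (hmain n fun j => e'.symm (y j)).trans (le_of_eq ?_)
    have h1 : ∀ j, (e (e'.symm (y j)) : Z) = ((y j : W) : Z) := fun j => by
      have := congrArg (fun t : LinearMap.range e.toLinearMap => ((t : W) : Z)) (e'.apply_symm_apply (y j))
      exact this
    simp only [h1]
    rfl

end GlidingHump

/-! ### `L^r` contains no copy of `ℓ^1` for `1 < r < ∞` -/

section Parallelogram

open MeasureTheory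

/-- Apply the parallelogram law to squares raised to the power `r / 2`: concavity and subadditivity
for `r ≤ 2`, superadditivity and convexity for `r ≥ 2`. What matters later is that the constant is
below `2 ^ r` once `r > 1`. -/
theorem Real.abs_add_rpow_add_abs_sub_rpow_le {r : ℝ} (hr : 1 ≤ r) (a b : ℝ) :
    |a + b| ^ r + |a - b| ^ r ≤ max 2 (2 ^ (r - 1)) * (|a| ^ r + |b| ^ r) := by
  have hsq : ∀ t : ℝ, |t| ^ r = (t ^ 2) ^ (r / 2) := fun t => by
    rw [← sq_abs, ← Real.rpow_natCast, ← Real.rpow_mul (abs_nonneg _)]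
    congr 1
    push_cast
    ring
  simp only [hsq]
  have ha := sq_nonneg a
  have hb := sq_nonneg b
  have hX := sq_nonneg (a + b)
  have hY := sq_nonneg (a - b)
  have hsum : 0 ≤ (a ^ 2) ^ (r / 2) + (b ^ 2) ^ (r / 2) := by positivity
  rcases le_total r 2 with h2 | h2
  · have h1 := (Real.concaveOn_rpow (p := r / 2) (by linarith) (by linarith)).2
      (Set.mem_Ici.2 hX) (Set.mem_Ici.2 hY) (show (0 : ℝ) ≤ 1 / 2 by norm_num)
      (show (0 : ℝ) ≤ 1 / 2 by norm_num) (by norm_num)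
    simp only [smul_eq_mul] at h1
    rw [show 1 / 2 * (a + b) ^ 2 + 1 / 2 * (a - b) ^ 2 = a ^ 2 + b ^ 2 by ring] at h1
    have h3 := Real.rpow_add_le_add_rpow ha hb (p := r / 2) (by linarith) (by linarith)
    refine le_trans ?_ (mul_le_mul_of_nonneg_right (le_max_left _ _) hsum)
    linarith
  · have h1 := Real.add_rpow_le_rpow_add hX hY (p := r / 2) (by linarith)
    have h3 := (convexOn_rpow (p := r / 2) (by linarith)).2
      (Set.mem_Ici.2 ha) (Set.mem_Ici.2 hb) (show (0 : ℝ) ≤ 1 / 2 by norm_num)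
      (show (0 : ℝ) ≤ 1 / 2 by norm_num) (by norm_num)
    simp only [smul_eq_mul] at h3
    rw [show (a + b) ^ 2 + (a - b) ^ 2 = 4 * (1 / 2 * a ^ 2 + 1 / 2 * b ^ 2) by ring,
      Real.mul_rpow (by norm_num) (by positivity)] at h1
    have h4 : (4 : ℝ) ^ (r / 2) = 2 * 2 ^ (r - 1) := by
      rw [show (4 : ℝ) = 2 ^ (2 : ℝ) by norm_num, ← Real.rpow_mul (by norm_num),
        Real.rpow_sub_one (by norm_num)]
      field_simp
    rw [h4] at h1
    refine le_trans ?_ (mul_le_mul_of_nonneg_right (le_max_right _ _) hsum)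
    have h5 : (0 : ℝ) ≤ 2 ^ (r - 1) := by positivity
    nlinarith

variable {Ω : Type*} [MeasurableSpace Ω] {μ : Measure Ω} {r : ℝ≥0∞}

theorem MeasureTheory.Lp.norm_rpow_eq_integral (h0 : r ≠ 0) (h1 : r ≠ ∞) (f : Lp ℝ r μ) :
    ‖f‖ ^ r.toReal = ∫ x, |f x| ^ r.toReal ∂μ := by
  have hr : 0 < r.toReal := ENNReal.toReal_pos h0 h1
  have hi : 0 ≤ ∫ x, |f x| ^ r.toReal ∂μ := integral_nonneg fun x => by positivity
  rw [Lp.norm_def, (Lp.memLp f).eLpNorm_eq_integral_rpow_norm h0 h1]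
  simp only [Real.norm_eq_abs]
  rw [ENNReal.toReal_ofReal (by positivity), Real.rpow_inv_rpow hi hr.ne']

theorem MeasureTheory.Lp.norm_add_rpow_add_norm_sub_rpow_le (h0 : 1 ≤ r) (h1 : r ≠ ∞)
    (f g : Lp ℝ r μ) : ‖f + g‖ ^ r.toReal + ‖f - g‖ ^ r.toReal ≤
      max 2 (2 ^ (r.toReal - 1)) * (‖f‖ ^ r.toReal + ‖g‖ ^ r.toReal) := by
  have hr0 : r ≠ 0 := (zero_lt_one.trans_le h0).ne'
  have hr1 : 1 ≤ r.toReal := by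
    rwa [← ENNReal.toReal_one, ENNReal.toReal_le_toReal ENNReal.one_ne_top h1]
  have hint : ∀ f : Lp ℝ r μ, Integrable (fun x => |f x| ^ r.toReal) μ := fun f =>
    (Lp.memLp f).integrable_norm_rpow hr0 h1
  simp only [Lp.norm_rpow_eq_integral hr0 h1]
  rw [← integral_add (hint _) (hint _), ← integral_add (hint _) (hint _), ← integral_const_mul]
  refine integral_mono_ae ((hint _).add (hint _)) (((hint _).add (hint _)).const_mul _) ?_
  filter_upwards [Lp.coeFn_add f g, Lp.coeFn_sub f g] with x hx hy
  simp only [hx, hy, Pi.add_apply, Pi.sub_apply]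
  exact Real.abs_add_rpow_add_abs_sub_rpow_le hr1 _ _

/-- Induction by doubling: join two half-sums `f`, `g` as `f + g` or `f - g`. The hypothesis bounds
the two `r`-th powers together by `2 K^(m+1) C^r`, so one of them is at most half of that. -/
theorem exists_signs_norm_sum_rpow_le {F : Type*} [NormedAddCommGroup F] [NormedSpace ℝ F]
    {r K C : ℝ} (hr : 0 ≤ r) (hK : 0 ≤ K)
    (hF : ∀ f g : F, ‖f + g‖ ^ r + ‖f - g‖ ^ r ≤ K * (‖f‖ ^ r + ‖g‖ ^ r)) {x : ℕ → F}
    (hx : ∀ k, ‖x k‖ ≤ C) (m s : ℕ) :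
    ∃ ε : ℕ → ℝ, (∀ k, |ε k| = 1) ∧
      ‖∑ k ∈ Finset.Ico s (s + 2 ^ m), ε k • x k‖ ^ r ≤ K ^ m * C ^ r := by
  induction m generalizing s with
  | zero =>
    refine ⟨fun _ => 1, by simp, ?_⟩
    simpa using Real.rpow_le_rpow (norm_nonneg _) (hx s) hr
  | succ m ih =>
    obtain ⟨ε, hε, hε'⟩ := ih s
    obtain ⟨η, hη, hη'⟩ := ih (s + 2 ^ m)
    have key : ∀ c : ℝ, |c| = 1 → ∃ θ : ℕ → ℝ, (∀ k, |θ k| = 1) ∧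
        ∑ k ∈ Finset.Ico s (s + 2 ^ (m + 1)), θ k • x k =
          ∑ k ∈ Finset.Ico s (s + 2 ^ m), ε k • x k +
            c • ∑ k ∈ Finset.Ico (s + 2 ^ m) (s + 2 ^ m + 2 ^ m), η k • x k := by
      intro c hc
      refine ⟨fun k => if k < s + 2 ^ m then ε k else c * η k, fun k => ?_, ?_⟩
      · dsimp only
        split_ifs
        · exact hε k
        · rw [abs_mul, hc, hη, one_mul]
      · rw [show s + 2 ^ (m + 1) = s + 2 ^ m + 2 ^ m by ring,
          ← Finset.sum_Ico_consecutive _ (Nat.le_add_right s (2 ^ m))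
            (Nat.le_add_right (s + 2 ^ m) (2 ^ m)), Finset.smul_sum]
        refine congrArg₂ (· + ·) ?_ ?_
        · refine Finset.sum_congr rfl fun k hk => ?_
          simp only [if_pos (Finset.mem_Ico.1 hk).2]
        · refine Finset.sum_congr rfl fun k hk => ?_
          simp only [if_neg (Finset.mem_Ico.1 hk).1.not_gt, mul_smul]
    have h := hF (∑ k ∈ Finset.Ico s (s + 2 ^ m), ε k • x k)
      (∑ k ∈ Finset.Ico (s + 2 ^ m) (s + 2 ^ m + 2 ^ m), η k • x k)
    have h2 := h.trans (mul_le_mul_of_nonneg_left (add_le_add hε' hη') hK)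
    rw [show K * (K ^ m * C ^ r + K ^ m * C ^ r) = K ^ (m + 1) * C ^ r + K ^ (m + 1) * C ^ r by
      ring] at h2
    rcases le_or_gt (‖∑ k ∈ Finset.Ico s (s + 2 ^ m), ε k • x k +
        ∑ k ∈ Finset.Ico (s + 2 ^ m) (s + 2 ^ m + 2 ^ m), η k • x k‖ ^ r)
        (K ^ (m + 1) * C ^ r) with h3 | h3
    · obtain ⟨θ, hθ, hs⟩ := key 1 abs_one
      exact ⟨θ, hθ, by rwa [hs, one_smul]⟩
    · obtain ⟨θ, hθ, hs⟩ := key (-1) (by simp)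
      refine ⟨θ, hθ, ?_⟩
      rw [hs, neg_one_smul, ← sub_eq_add_neg]
      linarith

/-- `ℓ^1` does not embed into a normed space in which signs can be chosen as in `L^r`,
`1 < r < ∞`. -/
theorem not_bounded_below_of_rpow_parallelogram {F : Type*} [NormedAddCommGroup F]
    [NormedSpace ℝ F] {r K : ℝ} (hr : 0 < r) (hK : 0 < K) (hKr : K < 2 ^ r)
    (hF : ∀ f g : F, ‖f + g‖ ^ r + ‖f - g‖ ^ r ≤ K * (‖f‖ ^ r + ‖g‖ ^ r))
    (T : lp (fun _ : ℕ => ℝ) 1 →ₗ[ℝ] F) {C D : ℝ} (hT : ∀ x, ‖T x‖ ≤ C * ‖x‖) :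
    ¬ ∀ x, ‖x‖ ≤ D * ‖T x‖ := by
  intro hD
  have hs1 : ∀ k : ℕ, ‖(lp.single 1 k 1 : lp (fun _ : ℕ => ℝ) 1)‖ = 1 := fun k => by
    rw [lp.norm_single one_pos, norm_one]
  have hD0 : 0 ≤ D := by
    by_contra h
    have h1 := hD (lp.single 1 0 1)
    rw [hs1] at h1
    nlinarith [norm_nonneg (T (lp.single 1 0 1)), not_le.1 h]
  -- Signed sums of `2 ^ m` unit vectors have norm exactly `2 ^ m` in `ℓ^1`, while some choice of
  -- signs makes the `r`-th power of the image norm at most `K ^ m * C ^ r`. Since `2 ^ r / K > 1`,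
  -- this is impossible for large `m`.
  have hmain : ∀ m : ℕ, (2 ^ r / K) ^ m ≤ D ^ r * C ^ r := fun m => by
    obtain ⟨ε, hε, hle⟩ := exists_signs_norm_sum_rpow_le hr.le hK.le hF
      (x := fun k => T (lp.single 1 k 1)) (C := C)
      (fun k => (hT _).trans (by rw [hs1, mul_one])) m 0
    rw [zero_add] at hle
    have h1 : ‖∑ k ∈ Finset.Ico 0 (2 ^ m), lp.single (E := fun _ : ℕ => ℝ) 1 k (ε k)‖ =
        2 ^ m := by
      have h2 := lp.norm_sum_single (E := fun _ : ℕ => ℝ) (p := 1) (by simp) ε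
        (Finset.Ico 0 (2 ^ m))
      simpa [hε] using h2
    have h3 : T (∑ k ∈ Finset.Ico 0 (2 ^ m), lp.single (E := fun _ : ℕ => ℝ) 1 k (ε k)) =
        ∑ k ∈ Finset.Ico 0 (2 ^ m), ε k • T (lp.single 1 k 1) := by
      rw [map_sum]
      refine Finset.sum_congr rfl fun k _ => ?_
      rw [← map_smul, ← lp.single_smul, smul_eq_mul, mul_one]
    have h4 := hD (∑ k ∈ Finset.Ico 0 (2 ^ m), lp.single (E := fun _ : ℕ => ℝ) 1 k (ε k))
    rw [h1, h3] at h4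
    have h5 := Real.rpow_le_rpow (by positivity) h4 hr.le
    rw [Real.mul_rpow hD0 (norm_nonneg _)] at h5
    have h6 : ((2 : ℝ) ^ m) ^ r = (2 ^ r) ^ m := by
      rw [← Real.rpow_natCast, ← Real.rpow_natCast, ← Real.rpow_mul (by norm_num),
        ← Real.rpow_mul (by norm_num), mul_comm]
    rw [h6] at h5
    rw [div_pow, div_le_iff₀ (by positivity)]
    calc (2 ^ r) ^ m ≤ _ := h5
      _ ≤ D ^ r * (K ^ m * C ^ r) := mul_le_mul_of_nonneg_left hle (by positivity)
      _ = _ := by ring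
  obtain ⟨m, hm⟩ := pow_unbounded_of_one_lt (D ^ r * C ^ r) ((one_lt_div hK).2 hKr)
  exact (hmain m).not_gt hm

theorem finiteDimensional_of_isOneProjective_min_Lp {p : ℝ≥0∞} [Fact (1 ≤ p)] [Fact (1 ≤ r)]
    (hr1 : 1 < r) (hr : r ≠ ∞) {Ω : Type w} [MeasurableSpace Ω] {μ : Measure Ω}
    (h : IsOneProjective (minMultinorm p (Lp ℝ r μ))) : FiniteDimensional ℝ (Lp ℝ r μ) := by
  by_contra hinf
  have hinf' : ¬ FiniteDimensional ℝ (⊤ : Submodule ℝ (Lp ℝ r μ)) := fun h' =>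
    hinf (Module.Finite.equiv Submodule.topEquiv)
  obtain ⟨V, e, he, he'⟩ := h.containsCopy (W := ⊤) isClosed_univ hinf'
  -- Only level `1` of the copy is used, where multinorms are the original norms: this is a plain
  -- isomorphic embedding of `ℓ^1`.
  have hup := fun x => he.norm_le 1 fun _ => x
  have hlow := fun x => he'.norm_le 1 fun _ => e x
  simp only [PMultinorm.norm_fin_one, LinearEquiv.coe_coe, LinearEquiv.symm_apply_apply]
    at hup hlow
  have hr1' : 1 < r.toReal := by
    rwa [← ENNReal.toReal_one, ENNReal.toReal_lt_toReal ENNReal.one_ne_top hr]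
  have hK : max 2 (2 ^ (r.toReal - 1)) < (2 : ℝ) ^ r.toReal := by
    refine max_lt ?_ (Real.rpow_lt_rpow_of_exponent_lt (by norm_num) (by linarith))
    simpa using Real.rpow_lt_rpow_of_exponent_lt (x := (2 : ℝ)) (by norm_num) hr1'
  refine not_bounded_below_of_rpow_parallelogram (zero_lt_one.trans hr1')
    (zero_lt_two.trans_le (le_max_left _ _)) hK
    (Lp.norm_add_rpow_add_norm_sub_rpow_le hr1.le hr)
    ((⊤ : Submodule ℝ (Lp ℝ r μ)).subtype ∘ₗ V.subtype ∘ₗ e.toLinearMap) hup hlow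

end Parallelogram

/-! ### Duality of `ℓ^p_m` and the structure of finite-dimensional `L^r` -/

section FiniteDimensionalLp

open MeasureTheory

/-- The dual of `ℓ^p_m` is `ℓ^r_m`, `1/p + 1/r = 1`. -/
theorem SeqLp.norm_dual_eq {p r : ℝ≥0∞} [Fact (1 ≤ p)] [Fact (1 ≤ r)]
    (h : p.toReal.HolderConjugate r.toReal) {m : ℕ} (b : SeqLp p m →L[ℝ] ℝ) :
    ‖b‖ = (∑ j, |b (PiLp.single p j 1)| ^ r.toReal) ^ (1 / r.toReal) := by
  apply le_antisymm
  · refine b.opNorm_le_bound (by positivity) fun a => ?_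
    have key : ∀ a : SeqLp p m, b a ≤
        (∑ j, |b (PiLp.single p j 1)| ^ r.toReal) ^ (1 / r.toReal) * ‖a‖ := fun a => by
      rw [SeqLp.map_eq_sum b a, PiLp.norm_eq_sum h.pos, mul_comm]
      exact Real.inner_le_Lp_mul_Lq _ _ _ h
    rw [Real.norm_eq_abs, abs_le']
    refine ⟨key a, ?_⟩
    have := key (-a)
    rwa [map_neg, norm_neg] at this
  · obtain ⟨⟨g, hg, hgs⟩, -⟩ := NNReal.isGreatest_Lp Finset.univ
      (fun j => ‖b (PiLp.single p j 1)‖₊) h.symm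
    -- Equality case of Hölder: the extremal vector for the absolute values, with signs restored.
    -- The sign of `0` is `0`, which only decreases `‖a‖`.
    let a : SeqLp p m := WithLp.toLp p fun j => SignType.sign (b (PiLp.single p j 1)) * (g j : ℝ)
    have ha : ‖a‖ ≤ 1 := by
      rw [PiLp.norm_eq_sum h.pos]
      refine Real.rpow_le_one (by positivity) ?_ (by have := h.pos; positivity)
      have hg' : ∑ j, (g j : ℝ) ^ p.toReal ≤ 1 := by exact_mod_cast hg
      refine le_trans (Finset.sum_le_sum fun j _ => ?_) hg'
      refine Real.rpow_le_rpow (norm_nonneg _) ?_ h.nonneg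
      simp only [a, norm_mul, Real.norm_eq_abs, NNReal.abs_eq]
      refine mul_le_of_le_one_left (g j).2 ?_
      rcases lt_trichotomy (b (PiLp.single p j 1)) 0 with h | h | h <;> simp [h]
    have hab : b a = (∑ j, |b (PiLp.single p j 1)| ^ r.toReal) ^ (1 / r.toReal) := by
      have h1 := congrArg (fun t : NNReal => (t : ℝ)) hgs
      push_cast at h1
      simp only [Real.norm_eq_abs] at h1
      rw [← h1, SeqLp.map_eq_sum b a]
      refine Finset.sum_congr rfl fun j _ => ?_
      simp only [a, smul_eq_mul]
      rw [mul_right_comm, sign_mul_self]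
    rw [← hab]
    exact (le_abs_self _).trans ((b.le_opNorm a).trans (mul_le_of_le_one_right (norm_nonneg _) ha))

variable {Ω : Type*} [MeasurableSpace Ω] {μ : Measure Ω} {r : ℝ≥0∞}

/-- Simple functions are dense and every subspace is closed in finite dimension, so indicators
already span; finitely many of them suffice. -/
theorem MeasureTheory.Lp.exists_finset_indicator_span [Fact (1 ≤ r)] (hr : r ≠ ∞)
    [FiniteDimensional ℝ (Lp ℝ r μ)] :
    ∃ t : Finset (Lp ℝ r μ), Submodule.span ℝ (t : Set (Lp ℝ r μ)) = ⊤ ∧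
      ∀ f ∈ t, ∃ (s : Set Ω) (hs : MeasurableSet s) (hμ : μ s ≠ ∞),
        f = indicatorConstLp r hs hμ 1 := by
  let S : Set (Lp ℝ r μ) := {f | ∃ (s : Set Ω) (hs : MeasurableSet s) (hμ : μ s ≠ ∞),
    f = indicatorConstLp r hs hμ 1}
  have hS : Submodule.span ℝ S = ⊤ := by
    rw [Submodule.eq_top_iff']
    refine Lp.induction hr _ ?_ ?_ ?_
    · intro c s hs hμs
      rw [Lp.simpleFunc.coe_indicatorConst]
      have h1 : indicatorConstLp r hs hμs.ne c = c • indicatorConstLp r hs hμs.ne (1 : ℝ) := by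
        refine Lp.ext ?_
        filter_upwards [indicatorConstLp_coeFn (p := r) (hs := hs) (hμs := hμs.ne) (c := c),
          indicatorConstLp_coeFn (p := r) (hs := hs) (hμs := hμs.ne) (c := (1 : ℝ)),
          Lp.coeFn_smul c (indicatorConstLp r hs hμs.ne (1 : ℝ))] with ω h1 h2 h3
        rw [h1, h3, Pi.smul_apply, h2]
        by_cases hω : ω ∈ s <;> simp [hω]
      rw [h1]
      exact Submodule.smul_mem _ _ (Submodule.subset_span ⟨s, hs, hμs.ne, rfl⟩)
    · intro f g hf hg _ h1 h2
      exact Submodule.add_mem _ h1 h2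
    · exact (Submodule.span ℝ S).closed_of_finiteDimensional
  obtain ⟨t, htS, ht⟩ := (Submodule.fg_span_iff_fg_span_finset_subset S).1
    (hS ▸ Module.Finite.fg_top)
  exact ⟨t, by rw [← ht, hS], fun f hf => htS hf⟩

/-- A finite-dimensional `L^r(μ)` is spanned by indicators of disjoint sets. -/
theorem MeasureTheory.Lp.exists_disjoint_indicator_span [Fact (1 ≤ r)] (hr : r ≠ ∞)
    [FiniteDimensional ℝ (Lp ℝ r μ)] :
    ∃ (m : ℕ) (A : Fin m → Set Ω) (hA : ∀ i, MeasurableSet (A i)) (hμ : ∀ i, μ (A i) ≠ ∞),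
      (∀ i, μ (A i) ≠ 0) ∧ Pairwise (fun i j => Disjoint (A i) (A j)) ∧
      Submodule.span ℝ (Set.range fun i => indicatorConstLp r (hA i) (hμ i) (1 : ℝ)) = ⊤ := by
  classical
  obtain ⟨t, ht, hts⟩ := Lp.exists_finset_indicator_span (μ := μ) hr
  choose s hs hμs hf using fun f : t => hts f f.2
  -- `τ ω` records which generating sets contain `ω`; its fibres `B σ` are the atoms of the finite
  -- algebra they generate.
  let τ : Ω → Finset t := fun ω => Finset.univ.filter fun f => ω ∈ s f
  have hτ : ∀ ω f, f ∈ τ ω ↔ ω ∈ s f := fun ω f => by simp [τ]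
  let B : Finset t → Set Ω := fun σ => {ω | τ ω = σ}
  have hB : ∀ σ, MeasurableSet (B σ) := fun σ => by
    have h1 : B σ = ⋂ f : t, {ω | ω ∈ s f ↔ f ∈ σ} := by
      ext ω
      simp only [B, Set.mem_iInter, Set.mem_ofPred_eq, Finset.ext_iff, hτ]
    rw [h1]
    refine MeasurableSet.iInter fun f => ?_
    by_cases hfσ : f ∈ σ
    · simpa [hfσ] using hs f
    · simp only [hfσ, iff_false]
      exact (hs f).compl
  -- Discarding the other atoms costs nothing: null atoms vanish almost everywhere, and an atom
  -- inside some `s f` has finite measure.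
  let Λ : Type _ := {σ : Finset t // μ (B σ) ≠ 0 ∧ μ (B σ) ≠ ∞}
  let φ := (Fintype.equivFin Λ).symm
  refine ⟨Fintype.card Λ, fun i => B (φ i).1, fun i => hB _, fun i => (φ i).2.2,
    fun i => (φ i).2.1, fun i j hij => ?_, ?_⟩
  · refine Set.disjoint_left.2 ?_
    intro ω h1 h2
    exact hij (φ.injective (Subtype.ext (h1.symm.trans h2)))
  · rw [eq_top_iff, ← ht, Submodule.span_le]
    intro f hft
    have h1 : f = ∑ i, (if (⟨f, hft⟩ : t) ∈ (φ i).1 then (1 : ℝ) else 0) •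
        indicatorConstLp r (hB (φ i).1) (φ i).2.2 (1 : ℝ) := by
      refine (hf ⟨f, hft⟩).trans ?_
      have hnull : ∀ᵐ ω ∂μ, μ (B (τ ω)) ≠ 0 := by
        have h2 : {ω | ¬ μ (B (τ ω)) ≠ 0} ⊆ ⋃ σ ∈ {σ | μ (B σ) = 0}, B σ := by
          intro ω hω
          simp only [Set.mem_iUnion]
          exact ⟨τ ω, not_not.1 hω, rfl⟩
        exact measure_mono_null h2
          ((measure_biUnion_null_iff (Set.to_countable _)).2 fun σ hσ => hσ)
      have hsum : ⇑(∑ i, (if (⟨f, hft⟩ : t) ∈ (φ i).1 then (1 : ℝ) else 0) •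
          indicatorConstLp r (hB (φ i).1) (φ i).2.2 (1 : ℝ)) =ᵐ[μ]
          ∑ i, ⇑((if (⟨f, hft⟩ : t) ∈ (φ i).1 then (1 : ℝ) else 0) •
            indicatorConstLp r (hB (φ i).1) (φ i).2.2 (1 : ℝ)) := Lp.coeFn_finsetSum _ _
      have hall : ∀ i, ⇑((if (⟨f, hft⟩ : t) ∈ (φ i).1 then (1 : ℝ) else 0) •
          indicatorConstLp r (hB (φ i).1) (φ i).2.2 (1 : ℝ)) =ᵐ[μ] fun ω =>
          (if (⟨f, hft⟩ : t) ∈ (φ i).1 then (1 : ℝ) else 0) *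
            (B (φ i).1).indicator (fun _ => 1) ω := fun i => by
        filter_upwards [Lp.coeFn_smul (if (⟨f, hft⟩ : t) ∈ (φ i).1 then (1 : ℝ) else 0)
          (indicatorConstLp r (hB (φ i).1) (φ i).2.2 (1 : ℝ)),
          indicatorConstLp_coeFn (p := r) (hs := hB (φ i).1) (hμs := (φ i).2.2) (c := (1 : ℝ))]
          with ω h3 h4
        rw [h3, Pi.smul_apply, h4, smul_eq_mul]
      refine Lp.ext ?_
      filter_upwards [hnull, hsum, ae_all_iff.2 hall, indicatorConstLp_coeFn (p := r)
        (hs := hs ⟨f, hft⟩) (hμs := hμs ⟨f, hft⟩) (c := (1 : ℝ))] with ω h2 h3 h4 h5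
      rw [h3, h5, Finset.sum_apply]
      simp only [h4]
      by_cases hω : ω ∈ s ⟨f, hft⟩
      · have hfin : μ (B (τ ω)) ≠ ∞ := by
          refine measure_ne_top_of_subset (fun ω' hω' => ?_) (hμs ⟨f, hft⟩)
          rw [← hτ, show τ ω' = τ ω from hω', hτ]
          exact hω
        rw [Finset.sum_eq_single (φ.symm ⟨τ ω, h2, hfin⟩)]
        · have h6 : ω ∈ B (τ ω) := rfl
          simp [(hτ ω ⟨f, hft⟩).2 hω, hω, h6]
        · intro i _ hi
          have h6 : ω ∉ B (φ i).1 := fun h6 => hi (by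
            rw [Equiv.eq_symm_apply]
            exact Subtype.ext (show τ ω = (φ i).1 from h6).symm)
          simp [h6]
        · simp
      · rw [Set.indicator_of_notMem hω]
        refine (Finset.sum_eq_zero fun i _ => ?_).symm
        by_cases h6 : ω ∈ B (φ i).1
        · have h7 : (⟨f, hft⟩ : t) ∉ (φ i).1 := by
            rw [← show τ ω = (φ i).1 from h6, hτ]
            exact hω
          simp [h7]
        · simp [h6]
    rw [h1]
    exact Submodule.sum_mem _ fun i _ => Submodule.smul_mem _ _ (Submodule.subset_span ⟨i, rfl⟩)

end FiniteDimensionalLp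

/-! ### Finite-dimensional `L^r` as a dual of `ℓ^p_m` -/

section DualIsometry

open MeasureTheory

/-- At each point at most one indicator is nonzero, so the `r`-th power passes inside the sum. -/
theorem MeasureTheory.Lp.norm_sum_indicator_rpow {Ω : Type*} [MeasurableSpace Ω] {μ : Measure Ω}
    {r : ℝ≥0∞} [Fact (1 ≤ r)] (hr : r ≠ ∞) {m : ℕ} {A : Fin m → Set Ω}
    (hA : ∀ i, MeasurableSet (A i)) (hμ : ∀ i, μ (A i) ≠ ∞)
    (hd : Pairwise fun i j => Disjoint (A i) (A j)) (c : Fin m → ℝ) :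
    ‖∑ i, c i • indicatorConstLp r (hA i) (hμ i) (1 : ℝ)‖ ^ r.toReal =
      ∑ i, |c i| ^ r.toReal * μ.real (A i) := by
  have hr0 : r ≠ 0 := (zero_lt_one.trans_le (Fact.out : 1 ≤ r)).ne'
  have hr1 : r.toReal ≠ 0 := (ENNReal.toReal_pos hr0 hr).ne'
  rw [Lp.norm_rpow_eq_integral hr0 hr]
  have hall : ∀ i, ⇑(c i • indicatorConstLp r (hA i) (hμ i) (1 : ℝ)) =ᵐ[μ]
      fun ω => c i * (A i).indicator (fun _ => 1) ω := fun i => by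
    filter_upwards [Lp.coeFn_smul (c i) (indicatorConstLp r (hA i) (hμ i) (1 : ℝ)),
      indicatorConstLp_coeFn (p := r) (hs := hA i) (hμs := hμ i) (c := (1 : ℝ))] with ω h3 h4
    rw [h3, Pi.smul_apply, h4, smul_eq_mul]
  have hae : (fun ω => |(∑ i, c i • indicatorConstLp r (hA i) (hμ i) (1 : ℝ) : Lp ℝ r μ) ω| ^
      r.toReal) =ᵐ[μ] fun ω => ∑ i, (A i).indicator (fun _ => |c i| ^ r.toReal) ω := by
    filter_upwards [ae_all_iff.2 hall,
      Lp.coeFn_finsetSum Finset.univ fun i => c i • indicatorConstLp r (hA i) (hμ i) (1 : ℝ)]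
      with ω h1 h2
    rw [h2, Finset.sum_apply]
    simp only [h1]
    by_cases hω : ∃ i, ω ∈ A i
    · obtain ⟨i, hi⟩ := hω
      have hne : ∀ j, j ≠ i → ω ∉ A j := fun j hj h => Set.disjoint_left.1 (hd hj) h hi
      rw [Finset.sum_eq_single i (fun j _ hj => by simp [hne j hj]) (by simp),
        Finset.sum_eq_single i (fun j _ hj => by simp [hne j hj]) (by simp)]
      simp [hi]
    · push Not at hω
      simp [hω, hr1]
  rw [integral_congr_ae hae, integral_finsetSum _ fun i _ =>
    (integrable_indicator_iff (hA i)).2 (integrableOn_const (hμ i))]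
  refine Finset.sum_congr rfl fun i _ => ?_
  rw [integral_indicator_const _ (hA i), smul_eq_mul, mul_comm]

/-- A finite-dimensional `L^r(μ)` is isometric to the dual of some `ℓ^p_m`. -/
theorem exists_dual_isometry_Lp {p r : ℝ≥0∞} [Fact (1 ≤ p)] [Fact (1 ≤ r)]
    (h : p.toReal.HolderConjugate r.toReal) (hr : r ≠ ∞) {Ω : Type*} [MeasurableSpace Ω]
    (μ : Measure Ω) [FiniteDimensional ℝ (Lp ℝ r μ)] :
    ∃ m : ℕ, Nonempty ((SeqLp p m →L[ℝ] ℝ) ≃ₗᵢ[ℝ] Lp ℝ r μ) := by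
  obtain ⟨m, A, hA, hμ, hμ0, hd, hspan⟩ := Lp.exists_disjoint_indicator_span (μ := μ) hr
  have hr0 : 0 < r.toReal := h.symm.pos
  have hpos : ∀ i, 0 < μ.real (A i) := fun i => ENNReal.toReal_pos (hμ0 i) (hμ i)
  -- Chosen so that `d i` times the indicator of `A i` is a unit vector; these vectors then form an
  -- isometric `ℓ^r_m` basis.
  let d : Fin m → ℝ := fun i => μ.real (A i) ^ (-(1 / r.toReal))
  have hdpos : ∀ i, 0 < d i := fun i => Real.rpow_pos_of_pos (hpos i) _
  have hdr : ∀ i, d i ^ r.toReal * μ.real (A i) = 1 := fun i => by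
    simp only [d]
    rw [← Real.rpow_mul (hpos i).le, neg_mul, one_div_mul_cancel hr0.ne',
      Real.rpow_neg_one, inv_mul_cancel₀ (hpos i).ne']
  let J : (SeqLp p m →L[ℝ] ℝ) →ₗ[ℝ] Lp ℝ r μ :=
    { toFun := fun b => ∑ i, (b (PiLp.single p i 1) * d i) •
        indicatorConstLp r (hA i) (hμ i) (1 : ℝ)
      map_add' := fun b b' => by
        simp only [add_apply, add_mul, add_smul, Finset.sum_add_distrib]
      map_smul' := fun c b => by
        simp only [smul_apply, smul_eq_mul, mul_assoc, mul_smul, Finset.smul_sum,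
          RingHom.id_apply] }
  have hJ : ∀ b, ‖J b‖ = ‖b‖ := fun b => by
    rw [SeqLp.norm_dual_eq h b, one_div,
      Real.eq_rpow_inv (norm_nonneg _) (by positivity) hr0.ne']
    refine (Lp.norm_sum_indicator_rpow hr hA hμ hd _).trans (Finset.sum_congr rfl fun i _ => ?_)
    rw [abs_mul, abs_of_pos (hdpos i), Real.mul_rpow (abs_nonneg _) (hdpos i).le, mul_assoc,
      hdr, mul_one]
  have hsurj : Function.Surjective J := by
    rw [← LinearMap.range_eq_top, eq_top_iff, ← hspan, Submodule.span_le]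
    rintro _ ⟨i, rfl⟩
    refine ⟨(d i)⁻¹ • PiLp.proj p (fun _ : Fin m => ℝ) i, ?_⟩
    simp only [J, LinearMap.coe_mk, AddHom.coe_mk]
    rw [Finset.sum_eq_single i]
    · simp [(hdpos i).ne']
    · intro j _ hj
      simp [hj.symm]
    · simp
  exact ⟨m, ⟨LinearIsometryEquiv.ofSurjective ⟨J, hJ⟩ hsurj⟩⟩

end DualIsometry

/-! ### The corollary -/

theorem mainTheorem11 (p : ℝ≥0∞) [Fact (1 ≤ p)] :
    (∀ (Z : Type w) [NormedAddCommGroup Z] [NormedSpace ℝ Z] [CompleteSpace Z]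
        (γ : PMultinorm p Z), IsOneProjective γ →
        ∀ W : Submodule ℝ Z, IsClosed (W : Set Z) → ¬ FiniteDimensional ℝ W →
          ContainsCopy (maxMultinorm p (lp (fun _ : ℕ => ℝ) 1)) (γ.restrict W)) ∧
    (1 < p → p < ∞ →
      ∀ (p' : ℝ≥0∞) [Fact (1 ≤ p')], p.HolderConjugate p' →
        ∀ (Ω : Type w) [MeasurableSpace Ω] (μ : MeasureTheory.Measure Ω),
          IsOneProjective (minMultinorm p (MeasureTheory.Lp ℝ p' μ)) ↔
            FiniteDimensional ℝ (MeasureTheory.Lp ℝ p' μ)) := by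
  refine ⟨fun Z _ _ _ γ h W hWc hW => h.containsCopy hWc hW, ?_⟩
  intro hp1 hp p' _ hpp' Ω _ μ
  have hp1' : 1 < p.toReal := by
    rwa [← ENNReal.toReal_one, ENNReal.toReal_lt_toReal ENNReal.one_ne_top hp.ne]
  have hH : p.toReal.HolderConjugate p'.toReal := ENNReal.HolderConjugate.toReal hp1'
  have hp'top : p' ≠ ∞ := (ENNReal.toReal_pos_iff.1 hH.symm.pos).2.ne
  have hp'1 : 1 < p' := by
    rw [← ENNReal.toReal_lt_toReal ENNReal.one_ne_top hp'top, ENNReal.toReal_one]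
    exact hH.symm.lt
  refine ⟨finiteDimensional_of_isOneProjective_min_Lp hp'1 hp'top, fun _ => ?_⟩
  obtain ⟨m, ⟨J⟩⟩ := exists_dual_isometry_Lp hH hp'top μ
  exact isOneProjective_min_of_dual J
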